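/- Let $\mathcal H(\mathbb C^d)$ be the space of Hermitian operators on $\mathbb C^d$. A discrete POVM on $\mathbb C^d$ is a family $\mathrm M=(M_i)_{1\le i\le n}$ of positive semidefinite operators with $\sum_i M_i=\mathrm{Id}$; its distinguishability norm is $\|\Delta\|_{\mathrm M}=\sum_{i=1}^n|\operatorname{tr}(\Delta M_i)|$ for $\Delta\in\mathcal H(\mathbb C^d)$. The distinguishability norm of the uniform POVM $\mathrm U_d$ is $\|\Delta\|_{\mathrm U_d}=d\,\mathbb E\,|\langle\psi|\Delta|\psi\rangle|$, where $\psi$ is uniformly (Haar) distributed on the unit sphere of $\mathbb C^d$. There is an absolute constant $C>0$, and for every $0<\varepsilon<1$ there is a constant $c(\varepsilon)>0$ depending only on $\varepsilon$, such that the following holds for all integers $d\ge 1$ and $n$ with $$n\ \ge\ C\,\varepsilon^{-2}\,\max(1,|\log\varepsilon|)\,d^2 .$$ Let $\psi_1,\dots,\psi_n$ be independent random vectors, uniformly distributed on the unit sphere of $\mathbb C^d$, and let $P_i=|\psi_i\rangle\langle\psi_i|$, $S=P_1+\dots+P_n$ and $\mathrm M=(S^{-1/2}P_iS^{-1/2})_{1\le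 i\le n}$. Then, except on an event of probability less than $\exp(-c(\varepsilon)d)$, $S$ is invertible, so that $\mathrm M$ is a POVM, and $$(1-\varepsilon)\|\Delta\|_{\mathrm U_d}\ \le\ \|\Delta\|_{\mathrm M}\ \le\ (1+\varepsilon)\|\Delta\|_{\mathrm U_d}\qquad\text{for every }\Delta\in\mathcal H(\mathbb C^d).$$ -/

import Mathlib

noncomputable section

namespace RandomPOVM

open MeasureTheory
open scoped MatrixOrder ComplexOrder

/-- The unit sphere of `ℂ^d` (with its Hermitian norm). -/
abbrev UnitSphere (d : ℕ) : Type := Metric.sphere (0 : EuclideanSpace ℂ (Fin d)) 1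

/-- The uniform (Haar) probability measure on the unit sphere of `ℂ^d`: the surface measure induced
by Lebesgue measure on `ℂ^d = ℝ^{2d}`, normalized to total mass `1`. -/
def uniformSphere (d : ℕ) : Measure (UnitSphere d) :=
  ((volume : Measure (EuclideanSpace ℂ (Fin d))).toSphere Set.univ)⁻¹ •
    (volume : Measure (EuclideanSpace ℂ (Fin d))).toSphere

/-- The coordinates of a unit vector. -/
def coords {d : ℕ} (ψ : UnitSphere d) : Fin d → ℂ := (ψ : EuclideanSpace ℂ (Fin d)).ofLp

/-- The rank-one projection `|ψ⟩⟨ψ|`. -/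
def proj {d : ℕ} (ψ : UnitSphere d) : Matrix (Fin d) (Fin d) ℂ :=
  Matrix.vecMulVec (coords ψ) (star (coords ψ))

/-- `M = (M_i)` is a discrete POVM: positive operators that sum to the identity. -/
structure IsDiscretePOVM {d n : ℕ} (M : Fin n → Matrix (Fin d) (Fin d) ℂ) : Prop where
  posSemidef : ∀ i, (M i).PosSemidef
  sum_eq_one : ∑ i, M i = 1

/-- The distinguishability norm of a discrete POVM, `‖Δ‖_M = ∑ i, |tr (Δ M_i)|`. -/
def povmNorm {d n : ℕ} (M : Fin n → Matrix (Fin d) (Fin d) ℂ) (Δ : Matrix (Fin d) (Fin d) ℂ) : ℝ :=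
  ∑ i, ‖(Δ * M i).trace‖

/-- The distinguishability norm of the uniform POVM, `‖Δ‖_{U_d} = d 𝔼 |⟨ψ|Δ|ψ⟩|`, where `ψ` is a
Haar-distributed unit vector. -/
def uniformNorm (d : ℕ) (Δ : Matrix (Fin d) (Fin d) ℂ) : ℝ :=
  d * ∫ ψ : UnitSphere d, ‖star (coords ψ) ⬝ᵥ Δ.mulVec (coords ψ)‖ ∂(uniformSphere d)

/-- `S = ∑ i, |ψ_i⟩⟨ψ_i|`. -/
def frameSum {d n : ℕ} (ψ : Fin n → UnitSphere d) : Matrix (Fin d) (Fin d) ℂ :=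
  ∑ i, proj (ψ i)

/-- The family `(S^{-1/2} P_i S^{-1/2})_i` with `P_i = |ψ_i⟩⟨ψ_i|` and `S = ∑ i, P_i`. It is a POVM
exactly when `S` is invertible; otherwise the matrix inverse is `0` by convention. -/
def randomPOVM {d n : ℕ} (ψ : Fin n → UnitSphere d) (i : Fin n) : Matrix (Fin d) (Fin d) ℂ :=
  (CFC.sqrt (frameSum ψ))⁻¹ * proj (ψ i) * (CFC.sqrt (frameSum ψ))⁻¹

end RandomPOVM

end

/-! Write `q(ψ) = ⟨ψ|Δ|ψ⟩` and `‖Δ‖ = (|tr Δ|² + ∑ |Δ_ij|²)^{1/2}`, which is `traceNorm₂`. A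
Gaussian vector is `rψ` with `r` independent of the uniform vector `ψ`, and in an eigenbasis of `Δ`
its quadratic form is a weighted sum of independent exponential variables. The moments of `d q` are
therefore under control (`sphere_moments`): the second moment is `d/(d+1) ‖Δ‖²`, and the exponential
moments are bounded when `‖Δ‖ ≤ 1`. Consequently `uniformNorm` is equivalent to `traceNorm₂` up to
absolute constants (`traceNorm₂_le_uniformNorm`), and the empirical means of `d q` and of `|d q|`
obey a Bernstein inequality (`measureReal_abs_sum_ge_le`).

Hermitian matrices live in real dimension `O(d²)`, so the unit ball of `traceNorm₂` has a `δ`-net of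
size `(1 + 2/δ)^{O(d²)}`. The assumed lower bound on `n`, with `δ` proportional to `ε`, pays for the
union bound. By `close_of_close_on_net`, both empirical means are then within `e ‖Δ‖` of `‖Δ‖_U` and
of `tr Δ`, for all Hermitian `Δ` at once, with `e = 4δ`.

It remains to pass from `P_i` to `S^{-1/2} P_i S^{-1/2}`. The estimate for `tr Δ` may be applied to
the random matrix `H = (d/n) S - 1` itself. As `H` is traceless and its empirical mean is `tr (H (H
+ 1)) = tr H²`, this gives `‖H‖₂² ≤ e ‖H‖₂`, so `(d/n) S` is close to `1` even in Hilbert–Schmidt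
norm. Hence `S` is invertible, and with `A = ((d/n) S)^{1/2}` the matrix `Δ' = A⁻¹ Δ A⁻¹` is within
`O(e) ‖Δ‖` of `Δ`. Since `‖Δ‖_M` is exactly the empirical mean of `|d q|` for `Δ'`, it is close to
`‖Δ‖_U` (`randomPOVM_of_close`), and the equivalence of norms makes the error relative. -/

noncomputable section

namespace RandomPOVM

open MeasureTheory Real
open scoped MatrixOrder ComplexOrder

/-! ### Polar decomposition of a Gaussian measure -/

section Polar

variable {E : Type*} [NormedAddCommGroup E] [NormedSpace ℝ E] [MeasurableSpace E] [BorelSpace E]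
  [FiniteDimensional ℝ E] [Nontrivial E]

/-- Polar coordinates, as a statement on the image of a product measure. -/
theorem map_toSphere_prod_volumeIoiPow (μ : Measure E) [μ.IsAddHaarMeasure] :
    (μ.toSphere.prod (Measure.volumeIoiPow (Module.finrank ℝ E - 1))).map
      (fun p => (p.2 : ℝ) • (p.1 : E)) = μ := by
  have h := (μ.measurePreserving_homeomorphUnitSphereProd)
  have h2 : MeasurePreserving (homeomorphUnitSphereProd E).symm
      (μ.toSphere.prod (Measure.volumeIoiPow (Module.finrank ℝ E - 1)))
      (μ.comap Subtype.val) :=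
    h.symm (homeomorphUnitSphereProd E).toMeasurableEquiv
  have h3 : (fun p : Metric.sphere (0 : E) 1 × Set.Ioi (0 : ℝ) => (p.2 : ℝ) • (p.1 : E))
      = Subtype.val ∘ (homeomorphUnitSphereProd E).symm := by
    ext p; simp
  rw [h3, ← Measure.map_map measurable_subtype_coe h2.measurable, h2.map_eq,
    (MeasurableEmbedding.subtype_coe (measurableSet_singleton (0 : E)).compl).map_comap,
    Subtype.range_coe, restrict_compl_singleton]

/-- The Lebesgue measure weighted by `exp (-‖z‖ ^ 2)`. -/
def expNormSqMeasure (μ : Measure E) : Measure E :=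
  μ.withDensity fun z => ENNReal.ofReal (exp (-‖z‖ ^ 2))

theorem map_withDensity_comp {α β : Type*} [MeasurableSpace α] [MeasurableSpace β]
    {μ : Measure α} {g : α → β} (hg : Measurable g) {f : β → ENNReal} (hf : Measurable f) :
    (μ.withDensity (f ∘ g)).map g = (μ.map g).withDensity f := by
  ext s hs
  rw [Measure.map_apply hg hs, withDensity_apply _ (hg hs), withDensity_apply _ hs,
    Measure.restrict_map hg hs, lintegral_map hf hg]
  rfl

/-- A Gaussian measure is the image of the product of the uniform measure on the sphere and of a
radial probability measure. -/
theorem exists_radial_law (μ : Measure E) [μ.IsAddHaarMeasure]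
    (hfin : expNormSqMeasure μ Set.univ ≠ ⊤) :
    ∃ ρ : Measure ℝ, IsProbabilityMeasure ρ ∧
      (((μ.toSphere Set.univ)⁻¹ • μ.toSphere).prod ρ).map (fun p => p.2 • (p.1 : E))
        = (expNormSqMeasure μ Set.univ)⁻¹ • expNormSqMeasure μ := by
  set τ := μ.toSphere with hτ
  have hτ0 : τ Set.univ ≠ 0 :=
    Measure.measure_univ_ne_zero.2 (Measure.toSphere_ne_zero μ)
  have hτt : τ Set.univ ≠ ⊤ := measure_ne_top _ _
  set σ := (τ Set.univ)⁻¹ • τ with hσ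
  have hσp : IsProbabilityMeasure σ := ⟨by simp [hσ, ENNReal.inv_mul_cancel hτ0 hτt]⟩
  have hτσ : τ = τ Set.univ • σ := by
    rw [hσ, smul_smul, ENNReal.mul_inv_cancel hτ0 hτt, one_smul]
  set v := Measure.volumeIoiPow (Module.finrank ℝ E - 1)
  set w : ℝ → ENNReal := fun r => ENNReal.ofReal (exp (-r ^ 2)) with hw
  have hwm : Measurable w := by fun_prop
  set Z := expNormSqMeasure μ Set.univ with hZ
  have hZ0 : Z ≠ 0 := by
    rw [hZ, expNormSqMeasure, Ne, Measure.measure_univ_eq_zero]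
    intro h0
    rw [withDensity_eq_zero_iff (by fun_prop)] at h0
    have : ∀ᵐ z ∂μ, False := by
      filter_upwards [h0] with z hz
      simp [ENNReal.ofReal_eq_zero] at hz
      exact absurd hz (not_le.2 (exp_pos _))
    simp at this
    exact (NeZero.ne μ) this
  -- The density depends on the norm alone, which is the radial coordinate, so it can be moved onto
  -- the radial factor.
  have key : expNormSqMeasure μ = τ Set.univ •
      (σ.prod ((v.withDensity (w ∘ Subtype.val)).map Subtype.val)).map
        (fun p : Metric.sphere (0 : E) 1 × ℝ => p.2 • (p.1 : E)) := by
    have hm : Measurable (fun p : Metric.sphere (0 : E) 1 × Set.Ioi (0 : ℝ) =>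
        (p.2 : ℝ) • (p.1 : E)) := by fun_prop
    have e1 : σ.prod ((v.withDensity (w ∘ Subtype.val)).map Subtype.val)
        = (σ.prod (v.withDensity (w ∘ Subtype.val))).map (Prod.map id Subtype.val) := by
      rw [← Measure.map_prod_map σ (v.withDensity (w ∘ Subtype.val)) measurable_id
        measurable_subtype_coe, Measure.map_id]
    have hm2 : Measurable (fun p : Metric.sphere (0 : E) 1 × ℝ => p.2 • (p.1 : E)) := by fun_prop
    rw [e1, Measure.map_map hm2 (by fun_prop), ← Measure.map_smul, ← Measure.prod_smul_left,
      ← hτσ, prod_withDensity_right (by fun_prop)]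
    conv_lhs => rw [expNormSqMeasure, ← map_toSphere_prod_volumeIoiPow μ]
    rw [← map_withDensity_comp hm (by fun_prop)]
    have h1 : ∀ p : Metric.sphere (0 : E) 1 × Set.Ioi (0 : ℝ),
        ‖((p.2 : ℝ) • (p.1 : E))‖ = (p.2 : ℝ) := fun p => by
      rw [norm_smul, Real.norm_eq_abs, abs_of_pos p.2.2, norm_eq_of_mem_sphere, mul_one]
    have h2 : ((fun z : E => ENNReal.ofReal (exp (-‖z‖ ^ 2))) ∘
        fun p : Metric.sphere (0 : E) 1 × Set.Ioi (0 : ℝ) => (p.2 : ℝ) • (p.1 : E))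
        = fun p => (w ∘ Subtype.val) p.2 := by
      funext p
      change ENNReal.ofReal (exp (-‖((p.2 : ℝ) • (p.1 : E))‖ ^ 2)) = _
      rw [h1]
      rfl
    rw [h2]
    rfl
  -- The mass of the sphere and the Gaussian normalization go into the radial law; evaluating `key`
  -- on the whole space shows that its total mass is `1`.
  refine ⟨(Z⁻¹ * τ Set.univ) • (v.withDensity (w ∘ Subtype.val)).map Subtype.val, ?_, ?_⟩
  · have hkey := congrArg (fun m : Measure E => m Set.univ) key
    rw [← hZ, Measure.smul_apply, Measure.map_apply (by fun_prop) MeasurableSet.univ,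
      Set.preimage_univ, ← Set.univ_prod_univ, Measure.prod_prod, hσp.measure_univ, one_mul] at hkey
    constructor
    rw [Measure.smul_apply, smul_eq_mul, mul_assoc, ← smul_eq_mul (τ Set.univ), ← hkey]
    exact ENNReal.inv_mul_cancel hZ0 hfin
  · rw [Measure.prod_smul_right, Measure.map_smul, key, smul_smul]

end Polar

end RandomPOVM
end

noncomputable section

namespace RandomPOVM

open MeasureTheory Real
open scoped MatrixOrder ComplexOrder

/-! ### The complex Gaussian measure and independence of coordinates -/

section Gaussian

variable {d : ℕ}

/-- The standard complex Gaussian measure on `ℂ^d`, with density proportional to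
`exp (-‖z‖ ^ 2)`. -/
def complexGaussian (d : ℕ) : Measure (EuclideanSpace ℂ (Fin d)) :=
  (expNormSqMeasure (volume : Measure (EuclideanSpace ℂ (Fin d))) Set.univ)⁻¹ •
    expNormSqMeasure (volume : Measure (EuclideanSpace ℂ (Fin d)))

theorem integrable_exp_neg_norm_sq :
    Integrable (fun z : EuclideanSpace ℂ (Fin d) => exp (-‖z‖ ^ 2)) := by
  -- A non-integrable function has integral `0` by convention, whereas the Gaussian integral is
  -- positive.
  by_contra h
  have h1 := integral_undef h
  have h2 := GaussianFourier.integral_rexp_neg_mul_sq_norm (V := EuclideanSpace ℂ (Fin d))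
    (b := 1) one_pos
  simp only [neg_mul, one_mul, div_one] at h2
  rw [h1] at h2
  exact (rpow_pos_of_pos pi_pos _).ne h2

theorem expNormSqMeasure_univ_ne_top :
    expNormSqMeasure (volume : Measure (EuclideanSpace ℂ (Fin d))) Set.univ ≠ ⊤ := by
  rw [expNormSqMeasure, withDensity_apply _ MeasurableSet.univ, Measure.restrict_univ]
  exact (integrable_exp_neg_norm_sq (d := d)).lintegral_lt_top.ne

/-- The coordinates in an orthonormal basis, as a continuous real-linear equivalence. -/
def basisCoords (b : OrthonormalBasis (Fin d) ℂ (EuclideanSpace ℂ (Fin d))) :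
    EuclideanSpace ℂ (Fin d) ≃L[ℝ] (Fin d → ℂ) :=
  (ContinuousLinearEquiv.restrictScalars ℝ b.repr.toContinuousLinearEquiv).trans
    (PiLp.continuousLinearEquiv 2 ℝ (fun _ : Fin d => ℂ))

theorem basisCoords_apply (b : OrthonormalBasis (Fin d) ℂ (EuclideanSpace ℂ (Fin d)))
    (z : EuclideanSpace ℂ (Fin d)) (j : Fin d) : basisCoords b z j = b.repr z j := rfl

theorem sum_norm_sq_basisCoords (b : OrthonormalBasis (Fin d) ℂ (EuclideanSpace ℂ (Fin d)))
    (z : EuclideanSpace ℂ (Fin d)) : ∑ j, ‖basisCoords b z j‖ ^ 2 = ‖z‖ ^ 2 := by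
  rw [← b.repr.norm_map z, EuclideanSpace.norm_sq_eq]
  rfl

theorem integral_exp_neg_mul_norm_sq {a : ℝ} (ha : 0 < a) :
    ∫ w : ℂ, exp (-(a * ‖w‖ ^ 2)) = π / a := by
  have h := Complex.integral_rpow_mul_exp_neg_mul_rpow (p := 2) (q := 0) (b := a)
    (by norm_num) (by norm_num) ha
  norm_num [Real.rpow_neg_one] at h
  rw [h]; ring

theorem integral_norm_sq_mul_exp :
    ∫ w : ℂ, exp (-‖w‖ ^ 2) * ‖w‖ ^ 2 = π := by
  have h := Complex.integral_rpow_mul_exp_neg_mul_rpow (p := 2) (q := 2) (b := 1)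
    (by norm_num) (by norm_num) one_pos
  norm_num at h
  simpa only [mul_comm] using h

theorem integral_norm_pow_four_mul_exp :
    ∫ w : ℂ, exp (-‖w‖ ^ 2) * (‖w‖ ^ 2 * ‖w‖ ^ 2) = 2 * π := by
  have h := Complex.integral_rpow_mul_exp_neg_mul_rpow (p := 2) (q := 4) (b := 1)
    (by norm_num) (by norm_num) one_pos
  have h3 : Gamma 3 = 2 := by
    have := Real.Gamma_nat_eq_factorial 2
    norm_num only [Nat.cast_ofNat, Nat.factorial] at this; exact this
  have h4 : ∀ w : ℂ, ‖w‖ ^ (4 : ℝ) = ‖w‖ ^ 4 := fun w => by norm_cast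
  norm_num [h3, h4] at h
  rw [mul_comm, ← h]
  congr 1; ext w; ring

theorem integral_complexGaussian (F : EuclideanSpace ℂ (Fin d) → ℝ) :
    ∫ z, F z ∂(complexGaussian d) =
      (expNormSqMeasure (volume : Measure (EuclideanSpace ℂ (Fin d))) Set.univ)⁻¹.toReal *
        ∫ z : EuclideanSpace ℂ (Fin d), exp (-‖z‖ ^ 2) * F z := by
  rw [complexGaussian, integral_smul_measure, smul_eq_mul, expNormSqMeasure,
    integral_withDensity_eq_integral_toReal_smul (by fun_prop) (by simp)]
  congr 2
  ext z
  rw [ENNReal.toReal_ofReal (exp_pos _).le, smul_eq_mul]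

/-- In the coordinates of any orthonormal basis, Lebesgue measure becomes a Haar measure, hence a
multiple of the product measure. The multiple need not be computed: `k` is determined later by
taking all `f j = 1`. -/
theorem exists_integral_prod_eq (b : OrthonormalBasis (Fin d) ℂ (EuclideanSpace ℂ (Fin d))) :
    ∃ k : ℝ, ∀ f : Fin d → ℂ → ℝ, ∫ z, ∏ j, f j (basisCoords b z j) ∂(complexGaussian d) =
      k * ∏ j, ∫ w, exp (-‖w‖ ^ 2) * f j w := by
  have : (Measure.map (basisCoords b) volume).IsAddHaarMeasure :=
    (basisCoords b).isAddHaarMeasure_map volume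
  have hs := Measure.isAddLeftInvariant_eq_smul (Measure.map (basisCoords b) volume)
    (volume : Measure (Fin d → ℂ))
  set c := Measure.addHaarScalarFactor (Measure.map (basisCoords b) volume)
    (volume : Measure (Fin d → ℂ))
  refine ⟨(expNormSqMeasure (volume : Measure (EuclideanSpace ℂ (Fin d))) Set.univ)⁻¹.toReal * c,
    fun f => ?_⟩
  rw [integral_complexGaussian, mul_assoc]
  congr 1
  rw [← integral_fintype_prod_eq_prod (fun j w => exp (-‖w‖ ^ 2) * f j w)]
  change _ = (c : ℝ) * ∫ x : Fin d → ℂ, _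
  rw [← smul_eq_mul, ← NNReal.smul_def, ← integral_smul_nnreal_measure, ← hs,
    MeasurableEmbedding.integral_map (f := basisCoords b)
      (basisCoords b).toHomeomorph.measurableEmbedding]
  congr 1
  ext z
  rw [Finset.prod_mul_distrib, ← exp_sum, Finset.sum_neg_distrib]
  congr 3
  exact (sum_norm_sq_basisCoords b z).symm

instance : IsProbabilityMeasure (complexGaussian d) := by
  constructor
  have h0 : expNormSqMeasure (volume : Measure (EuclideanSpace ℂ (Fin d))) Set.univ ≠ 0 := by
    rw [expNormSqMeasure, withDensity_apply _ MeasurableSet.univ, Measure.restrict_univ]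
    rw [← ofReal_integral_eq_lintegral_ofReal integrable_exp_neg_norm_sq
      (Filter.Eventually.of_forall fun z => (exp_pos _).le)]
    have h2 := GaussianFourier.integral_rexp_neg_mul_sq_norm (V := EuclideanSpace ℂ (Fin d))
      (b := 1) one_pos
    simp only [neg_mul, one_mul, div_one] at h2
    rw [h2]
    simpa using rpow_pos_of_pos pi_pos _
  rw [complexGaussian, Measure.smul_apply, smul_eq_mul,
    ENNReal.inv_mul_cancel h0 expNormSqMeasure_univ_ne_top]

/-- The coordinates of a Gaussian vector in an orthonormal basis are independent. -/
theorem integral_prod_basisCoords (b : OrthonormalBasis (Fin d) ℂ (EuclideanSpace ℂ (Fin d)))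
    (f : Fin d → ℂ → ℝ) : ∫ z, ∏ j, f j (basisCoords b z j) ∂(complexGaussian d) =
      ∏ j, π⁻¹ * ∫ w, exp (-‖w‖ ^ 2) * f j w := by
  obtain ⟨k, hk⟩ := exists_integral_prod_eq b
  have h1 := hk fun _ _ => 1
  have h2 := integral_exp_neg_mul_norm_sq one_pos
  simp only [one_mul, div_one] at h2
  simp only [Finset.prod_const_one, integral_const, probReal_univ, smul_eq_mul, mul_one, h2,
    Finset.prod_const, Finset.card_univ, Fintype.card_fin] at h1
  rw [hk, Finset.prod_mul_distrib, Finset.prod_const, Finset.card_univ, Fintype.card_fin, inv_pow]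
  congr 1
  exact eq_inv_of_mul_eq_one_left h1.symm

/-- The product formula holds without integrability, so a nonzero value excludes the default value
`0` of an undefined integral. -/
theorem integrable_prod_basisCoords (b : OrthonormalBasis (Fin d) ℂ (EuclideanSpace ℂ (Fin d)))
    (f : Fin d → ℂ → ℝ) (hf : ∀ j, ∫ w, exp (-‖w‖ ^ 2) * f j w ≠ 0) :
    Integrable (fun z => ∏ j, f j (basisCoords b z j)) (complexGaussian d) := by
  by_contra h
  have h1 := integral_undef h
  rw [integral_prod_basisCoords] at h1
  obtain ⟨j, -, hj⟩ := Finset.prod_eq_zero_iff.1 h1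
  exact mul_ne_zero (inv_ne_zero pi_ne_zero) (hf j) hj

end Gaussian

end RandomPOVM
end

noncomputable section

namespace RandomPOVM

open MeasureTheory Real
open scoped MatrixOrder ComplexOrder

/-! ### Moments of diagonal Gaussian quadratic forms -/

section GaussianMoments

variable {d : ℕ}

theorem integrable_norm_sq_mul_norm_sq
    (b : OrthonormalBasis (Fin d) ℂ (EuclideanSpace ℂ (Fin d))) (j k : Fin d) :
    Integrable (fun z => ‖basisCoords b z j‖ ^ 2 * ‖basisCoords b z k‖ ^ 2) (complexGaussian d) ∧
    ∫ z, ‖basisCoords b z j‖ ^ 2 * ‖basisCoords b z k‖ ^ 2 ∂(complexGaussian d) =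
      1 + if j = k then 1 else 0 := by
  -- Both factors are spread over one-variable functions, so that a single product formula covers `j
  -- = k` and `j ≠ k`.
  set f : Fin d → ℂ → ℝ := fun i w =>
    (if i = j then ‖w‖ ^ 2 else 1) * (if i = k then ‖w‖ ^ 2 else 1) with hf
  have h0 := integral_exp_neg_mul_norm_sq one_pos
  simp only [one_mul, div_one] at h0
  have h2 := integral_norm_sq_mul_exp
  have h4 := integral_norm_pow_four_mul_exp
  have hI : ∀ i, ∫ w, exp (-‖w‖ ^ 2) * f i w = π * (1 + if i = j ∧ i = k then 1 else 0) := by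
    intro i
    by_cases hij : i = j <;> by_cases hik : i = k
    · simp only [hf, if_pos hij, if_pos hik, if_pos (And.intro hij hik), h4]
      ring
    · simp only [hf, if_pos hij, if_neg hik, mul_one, h2, if_neg fun h : i = j ∧ i = k => hik h.2,
        add_zero]
    · simp only [hf, if_neg hij, if_pos hik, one_mul, h2, if_neg fun h : i = j ∧ i = k => hij h.1,
        add_zero, mul_one]
    · simp only [hf, if_neg hij, if_neg hik, mul_one, h0, if_neg fun h : i = j ∧ i = k => hij h.1,
        add_zero]
  have hprod : ∀ z, ‖basisCoords b z j‖ ^ 2 * ‖basisCoords b z k‖ ^ 2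
      = ∏ i, f i (basisCoords b z i) := by
    intro z
    simp only [hf, Finset.prod_mul_distrib, Finset.prod_ite_eq', Finset.mem_univ, if_true]
  have hne : ∀ i, ∫ w, exp (-‖w‖ ^ 2) * f i w ≠ 0 := by
    intro i
    rw [hI]
    exact mul_ne_zero pi_ne_zero (by split_ifs <;> norm_num)
  simp only [hprod]
  refine ⟨integrable_prod_basisCoords b f hne, ?_⟩
  rw [integral_prod_basisCoords]
  simp only [hI, inv_mul_cancel_left₀ pi_ne_zero]
  by_cases hjk : j = k
  · subst hjk
    simp only [and_self, if_true]
    rw [Finset.prod_eq_single j] <;> simp +contextual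
  · have : ∀ i, ¬ (i = j ∧ i = k) := fun i h => hjk (h.1.symm.trans h.2)
    simp [this, hjk]

theorem integrable_coord_norm_sq
    (b : OrthonormalBasis (Fin d) ℂ (EuclideanSpace ℂ (Fin d))) (j : Fin d) :
    Integrable (fun z => ‖basisCoords b z j‖ ^ 2) (complexGaussian d) ∧
    ∫ z, ‖basisCoords b z j‖ ^ 2 ∂(complexGaussian d) = 1 := by
  set f : Fin d → ℂ → ℝ := fun i w => (if i = j then ‖w‖ ^ 2 else 1) with hf
  have h0 := integral_exp_neg_mul_norm_sq one_pos
  simp only [one_mul, div_one] at h0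
  have h2 := integral_norm_sq_mul_exp
  have hI : ∀ i, ∫ w, exp (-‖w‖ ^ 2) * f i w = π := by
    intro i
    by_cases hij : i = j <;>
      simp only [hf, hij, if_true, if_false, mul_one, h0, h2]
  have hprod : ∀ z, ‖basisCoords b z j‖ ^ 2 = ∏ i, f i (basisCoords b z i) := by
    intro z
    simp [hf]
  simp only [hprod]
  refine ⟨integrable_prod_basisCoords b f fun i => by rw [hI]; exact pi_ne_zero, ?_⟩
  rw [integral_prod_basisCoords]
  simp [hI]

/-- The first moment of a diagonal quadratic form of a Gaussian vector. -/
theorem integral_diagForm (b : OrthonormalBasis (Fin d) ℂ (EuclideanSpace ℂ (Fin d)))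
    (l : Fin d → ℝ) :
    Integrable (fun z => ∑ j, l j * ‖basisCoords b z j‖ ^ 2) (complexGaussian d) ∧
    ∫ z, ∑ j, l j * ‖basisCoords b z j‖ ^ 2 ∂(complexGaussian d) = ∑ j, l j := by
  have hi : ∀ j ∈ Finset.univ, Integrable (fun z => l j * ‖basisCoords b z j‖ ^ 2)
      (complexGaussian d) := fun j _ => (integrable_coord_norm_sq b j).1.const_mul _
  refine ⟨integrable_finsetSum _ hi, ?_⟩
  rw [integral_finsetSum _ hi]
  simp [integral_const_mul, (integrable_coord_norm_sq b _).2]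

/-- The second moment of a diagonal quadratic form of a Gaussian vector. -/
theorem integral_diagForm_sq (b : OrthonormalBasis (Fin d) ℂ (EuclideanSpace ℂ (Fin d)))
    (l : Fin d → ℝ) :
    ∫ z, (∑ j, l j * ‖basisCoords b z j‖ ^ 2) ^ 2 ∂(complexGaussian d) =
      (∑ j, l j) ^ 2 + ∑ j, l j ^ 2 := by
  have hexp : ∀ z, (∑ j, l j * ‖basisCoords b z j‖ ^ 2) ^ 2 =
      ∑ j, ∑ k, (l j * l k) * (‖basisCoords b z j‖ ^ 2 * ‖basisCoords b z k‖ ^ 2) := by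
    intro z
    rw [sq, Finset.sum_mul_sum]
    exact Finset.sum_congr rfl fun j _ => Finset.sum_congr rfl fun k _ => by ring
  have hi : ∀ j k, Integrable (fun z => (l j * l k) *
      (‖basisCoords b z j‖ ^ 2 * ‖basisCoords b z k‖ ^ 2)) (complexGaussian d) :=
    fun j k => (integrable_norm_sq_mul_norm_sq b j k).1.const_mul _
  simp only [hexp]
  rw [integral_finsetSum _ fun j _ => integrable_finsetSum _ fun k _ => hi j k]
  simp only [integral_finsetSum _ fun k _ => hi _ k, integral_const_mul,
    (integrable_norm_sq_mul_norm_sq b _ _).2, mul_add, mul_one, Finset.sum_add_distrib]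
  congr 1
  · rw [sq, Finset.sum_mul_sum]
  · refine Finset.sum_congr rfl fun j _ => ?_
    simp [sq]

/-- The exponential moments of a diagonal quadratic form of a Gaussian vector. -/
theorem integral_exp_diagForm (b : OrthonormalBasis (Fin d) ℂ (EuclideanSpace ℂ (Fin d)))
    (l : Fin d → ℝ) (hl : ∀ j, l j < 1) :
    Integrable (fun z => exp (∑ j, l j * ‖basisCoords b z j‖ ^ 2)) (complexGaussian d) ∧
    ∫ z, exp (∑ j, l j * ‖basisCoords b z j‖ ^ 2) ∂(complexGaussian d) = ∏ j, (1 - l j)⁻¹ := by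
  have hI : ∀ i, ∫ w : ℂ, exp (-‖w‖ ^ 2) * exp (l i * ‖w‖ ^ 2) = π / (1 - l i) := by
    intro i
    rw [← integral_exp_neg_mul_norm_sq (sub_pos.2 (hl i))]
    congr 1
    ext w
    rw [← exp_add]
    congr 1
    ring
  simp only [exp_sum]
  constructor
  · refine integrable_prod_basisCoords b (fun i w => exp (l i * ‖w‖ ^ 2)) fun i => ?_
    rw [hI]
    exact (div_pos pi_pos (sub_pos.2 (hl i))).ne'
  · rw [integral_prod_basisCoords b (fun i w => exp (l i * ‖w‖ ^ 2))]
    simp only [hI]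
    refine Finset.prod_congr rfl fun i _ => ?_
    field_simp

theorem inv_one_sub_le_exp {x : ℝ} (hx : x ≤ 1 / 2) : (1 - x)⁻¹ ≤ exp (x + x ^ 2) := by
  rw [inv_le_iff_one_le_mul₀ (by linarith)]
  rcases le_total x 0 with h | h
  · have h1 := add_one_le_exp (x + x ^ 2)
    nlinarith [pow_nonneg (neg_nonneg.2 h) 3]
  · have h1 := quadratic_le_exp_of_nonneg (x := x + x ^ 2) (by positivity)
    have h2 : 1 ≤ (1 + (x + x ^ 2) + (x + x ^ 2) ^ 2 / 2) * (1 - x) := by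
      have e : (1 + (x + x ^ 2) + (x + x ^ 2) ^ 2 / 2) * (1 - x)
          = 1 + x ^ 2 / 2 * ((1 - x) * (1 + x) ^ 2 - 2 * x) := by ring
      have : 0 ≤ (1 - x) * (1 + x) ^ 2 - 2 * x := by nlinarith
      rw [e]
      have := mul_nonneg (by positivity : 0 ≤ x ^ 2 / 2) this
      linarith
    calc 1 ≤ _ := h2
      _ ≤ _ := by gcongr; linarith

/-- The `x j` stand for plus or minus half the eigenvalues of a matrix with `traceNorm₂` at most
`1`; the product is the exponential moment of the corresponding form. -/
theorem prod_inv_one_sub_le {ι : Type*} [Fintype ι] (x : ι → ℝ)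
    (hx : (∑ j, x j) ^ 2 + ∑ j, x j ^ 2 ≤ 1 / 4) :
    (∀ j, x j ≤ 1 / 2) ∧ ∏ j, (1 - x j)⁻¹ ≤ 2 := by
  have h1 : ∀ j, x j ≤ 1 / 2 := by
    intro j
    have := Finset.single_le_sum (f := fun j => x j ^ 2) (fun i _ => sq_nonneg (x i))
      (Finset.mem_univ j)
    nlinarith [sq_nonneg (∑ j, x j)]
  refine ⟨h1, ?_⟩
  calc ∏ j, (1 - x j)⁻¹ ≤ ∏ j, exp (x j + x j ^ 2) :=
        Finset.prod_le_prod (fun j _ => inv_nonneg.2 (by linarith [h1 j]))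
          fun j _ => inv_one_sub_le_exp (h1 j)
    _ = exp (∑ j, x j + ∑ j, x j ^ 2) := by rw [← exp_sum, Finset.sum_add_distrib]
    -- With `s = ∑ x j`, the exponent is at most `s + 1/4 - s² = 1/2 - (s - 1/2)²`.
    _ ≤ exp (1 / 2) := exp_le_exp.2 (by nlinarith [sq_nonneg (∑ j, x j - 1 / 2)])
    _ ≤ 2 := by
        have h := exp_one_lt_d9
        have e : exp (1 / 2) * exp (1 / 2) = exp 1 := by rw [← exp_add]; norm_num
        nlinarith [exp_pos (1 / 2)]

theorem integral_cosh_diagForm_le (b : OrthonormalBasis (Fin d) ℂ (EuclideanSpace ℂ (Fin d)))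
    (l : Fin d → ℝ) (hl : (∑ j, l j) ^ 2 + ∑ j, l j ^ 2 ≤ 1) :
    Integrable (fun z => cosh ((∑ j, l j * ‖basisCoords b z j‖ ^ 2) / 2)) (complexGaussian d) ∧
    ∫ z, cosh ((∑ j, l j * ‖basisCoords b z j‖ ^ 2) / 2) ∂(complexGaussian d) ≤ 2 := by
  have e : ∀ c : ℝ, c ^ 2 = 1 / 4 → (∑ j, c * l j) ^ 2 + ∑ j, (c * l j) ^ 2 ≤ 1 / 4 := by
    intro c hc
    simp only [mul_pow, ← Finset.mul_sum, hc]
    linarith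
  have hp := prod_inv_one_sub_le _ (e (1 / 2) (by norm_num))
  have hm := prod_inv_one_sub_le _ (e (-1 / 2) (by norm_num))
  have ip := integral_exp_diagForm b _ fun j => (hp.1 j).trans_lt (by norm_num)
  have im := integral_exp_diagForm b _ fun j => (hm.1 j).trans_lt (by norm_num)
  have hc : ∀ z, cosh ((∑ j, l j * ‖basisCoords b z j‖ ^ 2) / 2) =
      (exp (∑ j, 1 / 2 * l j * ‖basisCoords b z j‖ ^ 2) +
        exp (∑ j, -1 / 2 * l j * ‖basisCoords b z j‖ ^ 2)) / 2 := by
    intro z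
    rw [cosh_eq]
    simp only [mul_assoc, ← Finset.mul_sum]
    congr 3 <;> ring
  simp only [hc]
  refine ⟨(ip.1.add im.1).div_const 2, ?_⟩
  rw [integral_div, integral_add ip.1 im.1, ip.2, im.2]
  linarith [hp.2, hm.2]

end GaussianMoments

end RandomPOVM
end

noncomputable section

namespace RandomPOVM

open MeasureTheory Real
open scoped MatrixOrder ComplexOrder

/-! ### Hermitian quadratic forms and the norm `traceNorm₂` -/

section QuadraticForm

variable {d : ℕ}

/-- The real number `re ⟨z|Δ|z⟩`. -/
def quadForm (Δ : Matrix (Fin d) (Fin d) ℂ) (z : EuclideanSpace ℂ (Fin d)) : ℝ :=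
  (star z.ofLp ⬝ᵥ Δ.mulVec z.ofLp).re

/-- The entries of a matrix, together with its trace. -/
def entriesTrace (d : ℕ) :
    Matrix (Fin d) (Fin d) ℂ →ₗ[ℂ] EuclideanSpace ℂ (Option (Fin d × Fin d)) where
  toFun Δ := WithLp.toLp 2 fun o => o.elim Δ.trace fun p => Δ p.1 p.2
  map_add' A B := by
    ext o
    cases o <;> simp
  map_smul' c A := by
    ext o
    cases o <;> simp

/-- The norm `(∑ |Δ_ij|² + |tr Δ|²)^{1/2}`, equivalent to `uniformNorm` on Hermitian matrices. -/
def traceNorm₂ (Δ : Matrix (Fin d) (Fin d) ℂ) : ℝ := ‖entriesTrace d Δ‖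

theorem traceNorm₂_sq (Δ : Matrix (Fin d) (Fin d) ℂ) :
    traceNorm₂ Δ ^ 2 = ‖Δ.trace‖ ^ 2 + ∑ i, ∑ j, ‖Δ i j‖ ^ 2 := by
  rw [traceNorm₂, EuclideanSpace.norm_sq_eq, Fintype.sum_option, Fintype.sum_prod_type]
  rfl

theorem traceNorm₂_nonneg (Δ : Matrix (Fin d) (Fin d) ℂ) : 0 ≤ traceNorm₂ Δ := norm_nonneg _

theorem star_dotProduct_mulVec_eq_quadForm {Δ : Matrix (Fin d) (Fin d) ℂ} (hΔ : Δ.IsHermitian)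
    (z : EuclideanSpace ℂ (Fin d)) :
    star z.ofLp ⬝ᵥ Δ.mulVec z.ofLp = (quadForm Δ z : ℂ) := by
  have := hΔ.im_star_dotProduct_mulVec_self z.ofLp
  exact Complex.ext rfl (by simpa using this)

/-- Diagonalization reduces Gaussian moments of a Hermitian form to those of a diagonal form in the
eigenbasis. -/
theorem quadForm_eq_sum {Δ : Matrix (Fin d) (Fin d) ℂ} (hΔ : Δ.IsHermitian)
    (z : EuclideanSpace ℂ (Fin d)) :
    quadForm Δ z = ∑ j, hΔ.eigenvalues j * ‖basisCoords hΔ.eigenvectorBasis z j‖ ^ 2 := by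
  set b := hΔ.eigenvectorBasis
  have h1 : star z.ofLp ⬝ᵥ Δ.mulVec z.ofLp =
      inner ℂ z (Matrix.toEuclideanLin Δ z) := by
    rw [EuclideanSpace.inner_eq_star_dotProduct, dotProduct_comm]
    rfl
  have hs := Matrix.isSymmetric_toEuclideanLin_iff.2 hΔ
  have h2 : ∀ j, inner ℂ (b j) (Matrix.toEuclideanLin Δ z) = hΔ.eigenvalues j * inner ℂ (b j) z := by
    intro j
    rw [← hs (b j) z]
    have : Matrix.toEuclideanLin Δ (b j) = (hΔ.eigenvalues j : ℂ) • b j := by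
      have := hΔ.mulVec_eigenvectorBasis j
      ext i
      have h := congrFun this i
      simpa using h
    rw [this, inner_smul_left]
    simp
  rw [quadForm, h1, ← b.sum_inner_mul_inner, Complex.re_sum]
  refine Finset.sum_congr rfl fun j _ => ?_
  rw [h2, basisCoords_apply, OrthonormalBasis.repr_apply_apply, mul_left_comm,
    ← inner_conj_symm z (b j), Complex.conj_mul']
  norm_cast

theorem trace_eq_ofReal_sum_eigenvalues {Δ : Matrix (Fin d) (Fin d) ℂ} (hΔ : Δ.IsHermitian) :
    Δ.trace = ((∑ j, hΔ.eigenvalues j : ℝ) : ℂ) := by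
  rw [hΔ.trace_eq_sum_eigenvalues]
  simp

theorem sum_norm_sq_eq_trace {m n : Type*} [Fintype m] [Fintype n] (A : Matrix m n ℂ) :
    ((∑ i, ∑ j, ‖A i j‖ ^ 2 : ℝ) : ℂ) = (A * A.conjTranspose).trace := by
  simp only [Matrix.trace, Matrix.diag_apply, Matrix.mul_apply, Matrix.conjTranspose_apply]
  push_cast
  refine Finset.sum_congr rfl fun i _ => Finset.sum_congr rfl fun j _ => ?_
  exact (Complex.mul_conj' _).symm

theorem sum_norm_sq_eq_sum_eigenvalues_sq {Δ : Matrix (Fin d) (Fin d) ℂ} (hΔ : Δ.IsHermitian) :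
    ∑ i, ∑ j, ‖Δ i j‖ ^ 2 = ∑ j, hΔ.eigenvalues j ^ 2 := by
  have h := sum_norm_sq_eq_trace Δ
  rw [hΔ.eq] at h
  have h2 : (Δ * Δ).trace = ((∑ j, hΔ.eigenvalues j ^ 2 : ℝ) : ℂ) := by
    conv_lhs => rw [hΔ.spectral_theorem, ← map_mul]
    rw [Unitary.conjStarAlgAut_apply, mul_assoc, Matrix.trace_mul_comm, mul_assoc,
      Unitary.coe_star_mul_self, mul_one, Matrix.diagonal_mul_diagonal, Matrix.trace_diagonal]
    simp [sq]
  rw [h2] at h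
  exact_mod_cast h

theorem traceNorm₂_sq_of_isHermitian {Δ : Matrix (Fin d) (Fin d) ℂ} (hΔ : Δ.IsHermitian) :
    traceNorm₂ Δ ^ 2 = (∑ j, hΔ.eigenvalues j) ^ 2 + ∑ j, hΔ.eigenvalues j ^ 2 := by
  rw [traceNorm₂_sq, sum_norm_sq_eq_sum_eigenvalues_sq hΔ, trace_eq_ofReal_sum_eigenvalues hΔ,
    Complex.norm_real, Real.norm_eq_abs, sq_abs]

theorem quadForm_smul (Δ : Matrix (Fin d) (Fin d) ℂ) (r : ℝ) (z : EuclideanSpace ℂ (Fin d)) :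
    quadForm Δ (r • z) = r ^ 2 * quadForm Δ z := by
  have h : (r • z).ofLp = (r : ℂ) • z.ofLp := by
    ext i
    simp
  rw [quadForm, h, Matrix.mulVec_smul, star_smul, smul_dotProduct, dotProduct_smul, smul_eq_mul,
    smul_eq_mul, ← mul_assoc, quadForm]
  have : star (r : ℂ) * r = ((r ^ 2 : ℝ) : ℂ) := by simp [sq]
  rw [this, Complex.re_ofReal_mul]

theorem continuous_quadForm (Δ : Matrix (Fin d) (Fin d) ℂ) : Continuous (quadForm Δ) := by
  unfold quadForm
  have h : Continuous fun z : EuclideanSpace ℂ (Fin d) => z.ofLp := PiLp.continuous_ofLp 2 _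
  fun_prop

theorem continuous_quadForm_sphere (Δ : Matrix (Fin d) (Fin d) ℂ) :
    Continuous fun ψ : UnitSphere d => quadForm Δ ψ :=
  (continuous_quadForm Δ).comp continuous_subtype_val

end QuadraticForm

/-! ### Moments of quadratic forms on the sphere -/

section SphereMoments

variable {d : ℕ} [NeZero d]

instance : Nontrivial (EuclideanSpace ℂ (Fin d)) := by
  have : Nonempty (Fin d) := ⟨0⟩
  infer_instance

instance : IsProbabilityMeasure (uniformSphere d) := by
  refine ⟨?_⟩
  rw [uniformSphere, Measure.smul_apply, smul_eq_mul]
  exact ENNReal.inv_mul_cancel (Measure.measure_univ_ne_zero.2 (Measure.toSphere_ne_zero _))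
    (measure_ne_top _ _)

theorem exists_radial_law_complexGaussian :
    ∃ ρ : Measure ℝ, IsProbabilityMeasure ρ ∧
      ((uniformSphere d).prod ρ).map (fun p => p.2 • (p.1 : EuclideanSpace ℂ (Fin d)))
        = complexGaussian d :=
  exists_radial_law volume expNormSqMeasure_univ_ne_top

theorem integrable_of_continuous_sphere {f : UnitSphere d → ℝ} (hf : Continuous f) :
    Integrable f (uniformSphere d) :=
  hf.integrable_of_hasCompactSupport (HasCompactSupport.of_compactSpace f)

/-- The radial part of a Gaussian vector has `𝔼 r² = d` and `𝔼 r⁴ = d (d + 1)`. -/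
theorem radial_moments {ρ : Measure ℝ} [IsProbabilityMeasure ρ]
    (hρ : ((uniformSphere d).prod ρ).map (fun p => p.2 • (p.1 : EuclideanSpace ℂ (Fin d)))
        = complexGaussian d) :
    Integrable (fun r => r ^ 2) ρ ∧ ∫ r, r ^ 2 ∂ρ = d ∧ ∫ r, (r ^ 2) ^ 2 ∂ρ = d * (d + 1) := by
  have hm : Measurable fun p : UnitSphere d × ℝ => p.2 • (p.1 : EuclideanSpace ℂ (Fin d)) := by
    fun_prop
  set b := EuclideanSpace.basisFun (Fin d) ℂ
  have hn : ∀ z : EuclideanSpace ℂ (Fin d), ∑ j, (1 : ℝ) * ‖basisCoords b z j‖ ^ 2 = ‖z‖ ^ 2 := by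
    intro z
    simp only [one_mul, sum_norm_sq_basisCoords]
  have hp : ∀ p : UnitSphere d × ℝ, ‖p.2 • (p.1 : EuclideanSpace ℂ (Fin d))‖ ^ 2 = p.2 ^ 2 := by
    intro p
    rw [norm_smul, norm_eq_of_mem_sphere, mul_one, Real.norm_eq_abs, sq_abs]
  have h1 := integral_diagForm b fun _ => (1 : ℝ)
  have h2 := integral_diagForm_sq b fun _ => (1 : ℝ)
  simp only [hn] at h1 h2
  rw [← hρ, integrable_map_measure (by fun_prop) hm.aemeasurable,
    integral_map hm.aemeasurable (by fun_prop)] at h1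
  rw [← hρ, integral_map hm.aemeasurable (by fun_prop)] at h2
  simp only [Function.comp_def, hp] at h1 h2
  rw [integral_fun_snd (fun r : ℝ => r ^ 2)] at h1
  rw [integral_fun_snd (fun r : ℝ => (r ^ 2) ^ 2)] at h2
  refine ⟨(Integrable.comp_snd_iff (f := fun r : ℝ => r ^ 2)
    (IsProbabilityMeasure.ne_zero (uniformSphere d))).1 h1.1, ?_, ?_⟩
  · simpa using h1.2
  · simp at h2
    rw [h2]
    ring

/-- For `z = rψ` the form is `r²` times its value at `ψ`, and independence splits the Gaussian
moments into radial and spherical factors. The `cosh` bound is Jensen's inequality in `r`: since `𝔼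
r² = d`, replacing `r²` by `d` can only decrease the mean of the convex function. -/
theorem sphere_moments {Δ : Matrix (Fin d) (Fin d) ℂ} (hΔ : Δ.IsHermitian) :
    d * ∫ ψ, quadForm Δ ψ ∂(uniformSphere d) = Δ.trace.re ∧
    d * (d + 1) * ∫ ψ, quadForm Δ ψ ^ 2 ∂(uniformSphere d) = traceNorm₂ Δ ^ 2 ∧
    (traceNorm₂ Δ ≤ 1 → ∫ ψ, cosh (d * quadForm Δ ψ / 2) ∂(uniformSphere d) ≤ 2) := by
  obtain ⟨ρ, hρp, hρ⟩ := exists_radial_law_complexGaussian (d := d)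
  obtain ⟨hri, hr1, hr2⟩ := radial_moments hρ
  have hm : Measurable fun p : UnitSphere d × ℝ => p.2 • (p.1 : EuclideanSpace ℂ (Fin d)) := by
    fun_prop
  have hc := continuous_quadForm Δ
  have hcs := continuous_quadForm_sphere Δ
  have h1 := (integral_diagForm hΔ.eigenvectorBasis hΔ.eigenvalues).2
  have h2 := integral_diagForm_sq hΔ.eigenvectorBasis hΔ.eigenvalues
  have h3 := integral_cosh_diagForm_le hΔ.eigenvectorBasis hΔ.eigenvalues
  rw [← traceNorm₂_sq_of_isHermitian hΔ] at h2 h3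
  simp only [← quadForm_eq_sum hΔ] at h1 h2 h3
  have a1 : AEStronglyMeasurable (fun z => cosh (quadForm Δ z / 2))
      (((uniformSphere d).prod ρ).map (fun p => p.2 • (p.1 : EuclideanSpace ℂ (Fin d)))) :=
    (continuous_cosh.comp (hc.div_const 2)).aestronglyMeasurable
  have a2 : AEStronglyMeasurable (fun z => quadForm Δ z ^ 2)
      (((uniformSphere d).prod ρ).map (fun p => p.2 • (p.1 : EuclideanSpace ℂ (Fin d)))) :=
    (hc.pow 2).aestronglyMeasurable
  rw [← hρ, integral_map hm.aemeasurable hc.aestronglyMeasurable] at h1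
  rw [← hρ, integral_map hm.aemeasurable a2] at h2
  rw [← hρ, integrable_map_measure a1 hm.aemeasurable, integral_map hm.aemeasurable a1] at h3
  simp only [Function.comp_def, quadForm_smul] at h1 h2 h3
  refine ⟨?_, ?_, fun hs => ?_⟩
  · simp only [mul_comm (_ ^ 2)] at h1
    rw [integral_prod_mul (fun ψ : UnitSphere d => quadForm Δ ψ) (fun r : ℝ => r ^ 2), hr1] at h1
    rw [trace_eq_ofReal_sum_eigenvalues hΔ, Complex.ofReal_re, ← h1, mul_comm]
  · simp only [mul_pow, mul_comm ((_ ^ 2) ^ 2)] at h2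
    rw [integral_prod_mul (fun ψ : UnitSphere d => quadForm Δ ψ ^ 2) (fun r : ℝ => (r ^ 2) ^ 2),
      hr2] at h2
    rw [← h2, mul_comm]
  · obtain ⟨hi, hle⟩ := h3 (by rw [sq_le_one_iff₀ (traceNorm₂_nonneg Δ)]; exact hs)
    -- Convexity of `cosh` in the form of its tangent at `v`, to be used at `v = d q / 2` and `u =
    -- r² q / 2`.
    have htan : ∀ u v : ℝ, cosh v + sinh v * (u - v) ≤ cosh u := by
      intro u v
      have e1 : exp u = exp v * exp (u - v) := by rw [← exp_add]; ring_nf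
      have e2 : exp (-u) = exp (-v) * exp (-(u - v)) := by rw [← exp_add]; ring_nf
      rw [cosh_eq, cosh_eq, sinh_eq, e1, e2]
      have i1 := mul_le_mul_of_nonneg_left (add_one_le_exp (u - v)) (exp_pos v).le
      have i2 := mul_le_mul_of_nonneg_left (add_one_le_exp (-(u - v))) (exp_pos (-v)).le
      linarith
    have c1 : Continuous fun ψ : UnitSphere d => cosh (d * quadForm Δ ψ / 2) := by
      have := continuous_cosh; fun_prop
    have c2 : Continuous fun ψ : UnitSphere d =>
        sinh (d * quadForm Δ ψ / 2) * (quadForm Δ ψ / 2) := by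
      have := continuous_sinh; fun_prop
    have j1 : Integrable (fun p : UnitSphere d × ℝ => cosh (d * quadForm Δ p.1 / 2))
        ((uniformSphere d).prod ρ) := (integrable_of_continuous_sphere c1).comp_fst ρ
    have j2 : Integrable (fun p : UnitSphere d × ℝ =>
        sinh (d * quadForm Δ p.1 / 2) * (quadForm Δ p.1 / 2) * (p.2 ^ 2 - d))
        ((uniformSphere d).prod ρ) :=
      (integrable_of_continuous_sphere c2).mul_prod (hri.sub (integrable_const (d : ℝ)))
    -- The tangent's linear term has mean zero, by independence and `𝔼 r² = d`.
    have hzero : ∫ p : UnitSphere d × ℝ,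
        sinh (d * quadForm Δ p.1 / 2) * (quadForm Δ p.1 / 2) * (p.2 ^ 2 - d)
        ∂((uniformSphere d).prod ρ) = 0 := by
      rw [integral_prod_mul (fun ψ : UnitSphere d =>
        sinh (d * quadForm Δ ψ / 2) * (quadForm Δ ψ / 2)) (fun r : ℝ => r ^ 2 - d),
        integral_sub hri (integrable_const _), hr1]
      simp
    calc ∫ ψ, cosh (d * quadForm Δ ψ / 2) ∂(uniformSphere d)
        = ∫ p : UnitSphere d × ℝ, cosh (d * quadForm Δ p.1 / 2) +
            sinh (d * quadForm Δ p.1 / 2) * (quadForm Δ p.1 / 2) * (p.2 ^ 2 - d)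
            ∂((uniformSphere d).prod ρ) := by
          rw [integral_add j1 j2, hzero, add_zero,
            integral_fun_fst (fun ψ : UnitSphere d => cosh (d * quadForm Δ ψ / 2))]
          simp
      _ ≤ ∫ p : UnitSphere d × ℝ, cosh (p.2 ^ 2 * quadForm Δ p.1 / 2)
            ∂((uniformSphere d).prod ρ) := by
          refine integral_mono (j1.add j2) hi fun p => ?_
          refine le_trans (le_of_eq ?_) (htan (p.2 ^ 2 * quadForm Δ p.1 / 2)
            (d * quadForm Δ p.1 / 2))
          ring
      _ ≤ 2 := hle

end SphereMoments

end RandomPOVM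
end

noncomputable section

namespace RandomPOVM

open MeasureTheory Real ProbabilityTheory
open scoped MatrixOrder ComplexOrder

/-! ### A Bernstein inequality from a `cosh` moment -/

section Concentration

theorem exp_sub_one_sub_le (x : ℝ) : exp x - 1 - x ≤ x ^ 2 * exp |x| := by
  rcases le_or_gt |x| 1 with h | h
  · have h1 := (abs_le.1 (abs_exp_sub_one_sub_id_le h)).2
    have h2 := one_le_exp (abs_nonneg x)
    nlinarith [sq_nonneg x]
  · rcases le_total 0 x with hx | hx
    · rw [abs_of_nonneg hx] at h ⊢
      nlinarith [exp_pos x, mul_pos (sub_pos.2 h) (exp_pos x),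
        mul_nonneg hx (mul_pos (sub_pos.2 h) (exp_pos x)).le]
    · have h2 := one_le_exp (abs_nonneg x)
      have h3 := exp_le_one_iff.2 hx
      rw [abs_of_nonpos hx] at h h2 ⊢
      nlinarith [sq_nonneg x]

/-- A Taylor expansion of order two. For `z = g - m`, the remainder factors `z²` and `exp |θ z|`
each cost at most a multiple of `exp (|z| / 8)`, and `|z| ≤ |y| + 1` turns the product into `cosh (y
/ 2)`. The constant is `512 = 128 · 2 · 2`. -/
theorem exp_mul_sub_le {θ y g m : ℝ} (hθ : |θ| ≤ 1 / 8) (hg : |g| ≤ |y|) (hm : |m| ≤ 1) :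
    exp (θ * (g - m)) ≤ 1 + θ * (g - m) + θ ^ 2 * (512 * cosh (y / 2)) := by
  set z := g - m
  have h1 := exp_sub_one_sub_le (θ * z)
  have hz : |z| ≤ |y| + 1 := (abs_sub g m).trans (by linarith)
  have h2 : |θ * z| ≤ |z| / 8 := by
    rw [abs_mul]
    nlinarith [abs_nonneg z]
  have h3 : z ^ 2 ≤ 128 * exp (|z| / 8) := by
    have := quadratic_le_exp_of_nonneg (x := |z| / 8) (by positivity)
    have e := sq_abs z
    nlinarith [abs_nonneg z]
  have h4 : exp (1 / 4) ≤ 2 := by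
    have h := exp_one_lt_d9
    have e : exp (1 / 4) ^ 4 = exp 1 := by rw [← exp_nat_mul]; norm_num
    by_contra! hc
    nlinarith [pow_lt_pow_left₀ hc (by norm_num) (by norm_num : (4 : ℕ) ≠ 0)]
  have h5 : exp (|y| / 2) ≤ 2 * cosh (y / 2) := by
    rw [← cosh_abs, abs_div, abs_two, cosh_eq]
    linarith [exp_pos (-(|y| / 2))]
  have h6 : z ^ 2 * exp |θ * z| ≤ 512 * cosh (y / 2) := by
    calc z ^ 2 * exp |θ * z| ≤ (128 * exp (|z| / 8)) * exp (|z| / 8) := by gcongr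
      _ = 128 * exp (|z| / 4) := by
          rw [mul_assoc, ← exp_add]; ring_nf
      _ ≤ 128 * exp (1 / 4 + |y| / 2) := by
          gcongr
          linarith [abs_nonneg y]
      _ = 128 * (exp (1 / 4) * exp (|y| / 2)) := by rw [exp_add]
      _ ≤ 128 * (2 * (2 * cosh (y / 2))) := by gcongr
      _ = 512 * cosh (y / 2) := by ring
  have h7 : (θ * z) ^ 2 * exp |θ * z| ≤ θ ^ 2 * (512 * cosh (y / 2)) := by
    rw [mul_pow, mul_assoc]
    gcongr
  linarith

variable {α : Type*} [MeasurableSpace α] {μ : Measure α} [IsProbabilityMeasure μ]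

theorem integrable_of_abs_le {f : α → ℝ} (hf : Measurable f) {B : ℝ} (hB : ∀ x, |f x| ≤ B) :
    Integrable f μ :=
  Integrable.of_bound hf.aestronglyMeasurable B (Filter.Eventually.of_forall hB)

/-- A bounded function dominated by a variable with controlled exponential moments has a centred
moment generating function that is sub-Gaussian near `0`. -/
theorem integral_exp_mul_sub_le {Y g : α → ℝ} {B : ℝ} (hY : Measurable Y) (hg : Measurable g)
    (hB : ∀ x, |Y x| ≤ B) (hgY : ∀ x, |g x| ≤ |Y x|) (hcosh : ∫ x, cosh (Y x / 2) ∂μ ≤ 2)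
    (hY1 : ∫ x, |Y x| ∂μ ≤ 1) {θ : ℝ} (hθ : |θ| ≤ 1 / 8) :
    ∫ x, exp (θ * (g x - ∫ y, g y ∂μ)) ∂μ ≤ exp (1024 * θ ^ 2) := by
  set m := ∫ y, g y ∂μ
  have ig : Integrable g μ := integrable_of_abs_le hg fun x => (hgY x).trans (hB x)
  have iY : Integrable (fun x => |Y x|) μ :=
    integrable_of_abs_le (_root_.continuous_abs.measurable.comp hY) (B := B) fun x => by
      rw [abs_abs]; exact hB x
  have hm : |m| ≤ 1 := (abs_integral_le_integral_abs).trans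
    ((integral_mono ig.abs iY hgY).trans hY1)
  have ic : Integrable (fun x => cosh (Y x / 2)) μ := by
    refine integrable_of_abs_le (continuous_cosh.measurable.comp (hY.div_const 2))
      (B := cosh (B / 2)) fun x => ?_
    rw [abs_of_pos (cosh_pos _), cosh_le_cosh, abs_div, abs_div]
    exact div_le_div_of_nonneg_right ((hB x).trans (le_abs_self B)) (abs_nonneg _)
  have ie : Integrable (fun x => exp (θ * (g x - m))) μ := by
    refine integrable_of_abs_le (by fun_prop) (B := exp (|θ| * (B + |m|))) fun x => ?_
    rw [abs_of_pos (exp_pos _), exp_le_exp]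
    refine (le_abs_self _).trans ?_
    rw [abs_mul]
    gcongr
    exact (abs_sub _ _).trans (by linarith [hgY x, hB x])
  have i1 : Integrable (fun x => θ * (g x - m)) μ := (ig.sub (integrable_const m)).const_mul θ
  have i2 : Integrable (fun x => θ ^ 2 * (512 * cosh (Y x / 2))) μ :=
    (ic.const_mul 512).const_mul (θ ^ 2)
  have i3 : Integrable (fun x => 1 + θ * (g x - m)) μ := (integrable_const 1).add i1
  calc ∫ x, exp (θ * (g x - m)) ∂μ
      ≤ ∫ x, 1 + θ * (g x - m) + θ ^ 2 * (512 * cosh (Y x / 2)) ∂μ :=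
        integral_mono ie (i3.add i2) fun x => exp_mul_sub_le hθ (hgY x) hm
    _ = 1 + θ ^ 2 * (512 * ∫ x, cosh (Y x / 2) ∂μ) := by
        rw [integral_add i3 i2, integral_add (integrable_const 1) i1, integral_const_mul,
          integral_const_mul, integral_const_mul, integral_sub ig (integrable_const m)]
        simp [m]
    _ ≤ 1 + 1024 * θ ^ 2 := by nlinarith [sq_nonneg θ]
    _ ≤ exp (1024 * θ ^ 2) := by linarith [add_one_le_exp (1024 * θ ^ 2)]

variable {Ω : Type*} [MeasurableSpace Ω] {P : Measure Ω} [IsProbabilityMeasure P] {n : ℕ}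
  {ψ : Fin n → Ω → α}

theorem measureReal_sum_ge_le (hind : iIndepFun ψ P) (hlaw : ∀ i, HasLaw (ψ i) μ P)
    {Y g : α → ℝ} {B : ℝ} (hY : Measurable Y) (hg : Measurable g)
    (hB : ∀ x, |Y x| ≤ B) (hgY : ∀ x, |g x| ≤ |Y x|) (hcosh : ∫ x, cosh (Y x / 2) ∂μ ≤ 2)
    (hY1 : ∫ x, |Y x| ∂μ ≤ 1) {t : ℝ} (ht0 : 0 ≤ t) (ht1 : t ≤ 1) :
    P.real {ω | n * t ≤ ∑ i, (g (ψ i ω) - ∫ y, g y ∂μ)} ≤ exp (-(n * t ^ 2 / 4096)) := by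
  set m := ∫ y, g y ∂μ
  -- The minimizer of `1024 θ² - θ t`, with minimum `-t² / 4096`.
  set θ := t / 2048 with hθ
  have hθ0 : 0 ≤ θ := by positivity
  have hθ8 : |θ| ≤ 1 / 8 := by rw [abs_of_nonneg hθ0]; linarith
  set Z : Fin n → Ω → ℝ := fun i ω => g (ψ i ω) - m with hZ
  have hZm : ∀ i, AEMeasurable (Z i) P := fun i =>
    (hg.comp_aemeasurable (hlaw i).aemeasurable).sub_const m
  have hZi : iIndepFun Z P := hind.comp (fun _ x => g x - m) fun _ => hg.sub_const m
  have hmgf : ∀ i, mgf (Z i) P θ ≤ exp (1024 * θ ^ 2) := by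
    intro i
    have := (hlaw i).integral_comp (f := fun x => exp (θ * (g x - m)))
      (by fun_prop)
    rw [mgf]
    exact (le_of_eq this).trans (integral_exp_mul_sub_le hY hg hB hgY hcosh hY1 hθ8)
  have hbd : ∀ ω, |(∑ i, Z i) ω| ≤ n * (B + |m|) := by
    intro ω
    rw [Finset.sum_apply]
    refine (Finset.abs_sum_le_sum_abs _ _).trans ?_
    refine (Finset.sum_le_card_nsmul _ _ (B + |m|) fun i _ => ?_).trans (le_of_eq (by simp [mul_add]))
    exact (abs_sub _ _).trans (by linarith [hgY (ψ i ω), hB (ψ i ω)])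
  have hint : Integrable (fun ω => exp (θ * (∑ i, Z i) ω)) P := by
    refine Integrable.of_bound (C := exp (θ * (n * (B + |m|)))) ?_
      (Filter.Eventually.of_forall fun ω => ?_)
    · have : AEMeasurable (∑ i, Z i) P := Finset.aemeasurable_sum _ fun i _ => hZm i
      exact (measurable_exp.comp_aemeasurable (this.const_mul θ)).aestronglyMeasurable
    · rw [Real.norm_eq_abs, abs_of_pos (exp_pos _), exp_le_exp]
      exact mul_le_mul_of_nonneg_left ((le_abs_self _).trans (hbd ω)) hθ0
  have hch := measure_ge_le_exp_mul_mgf (n * t) hθ0 hint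
  rw [hZi.mgf_sum₀ hZm] at hch
  have hset : {ω | n * t ≤ ∑ i, (g (ψ i ω) - m)} = {ω | n * t ≤ (∑ i, Z i) ω} := by
    ext ω
    simp [hZ]
  rw [hset]
  refine hch.trans ?_
  calc exp (-θ * (n * t)) * ∏ i, mgf (Z i) P θ
      ≤ exp (-θ * (n * t)) * ∏ _i : Fin n, exp (1024 * θ ^ 2) := by
        gcongr with i _
        · exact fun i _ => mgf_nonneg
        · exact hmgf i
    _ = exp (-(n * t ^ 2 / 4096)) := by
        rw [Finset.prod_const, Finset.card_univ, Fintype.card_fin, ← exp_nat_mul, ← exp_add, hθ]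
        congr 1
        ring

/-- A Bernstein-type inequality for empirical means. -/
theorem measureReal_abs_sum_ge_le (hind : iIndepFun ψ P) (hlaw : ∀ i, HasLaw (ψ i) μ P)
    {Y g : α → ℝ} {B : ℝ} (hY : Measurable Y) (hg : Measurable g)
    (hB : ∀ x, |Y x| ≤ B) (hgY : ∀ x, |g x| ≤ |Y x|) (hcosh : ∫ x, cosh (Y x / 2) ∂μ ≤ 2)
    (hY1 : ∫ x, |Y x| ∂μ ≤ 1) {t : ℝ} (ht0 : 0 ≤ t) (ht1 : t ≤ 1) :
    P.real {ω | n * t ≤ |∑ i, g (ψ i ω) - n * ∫ y, g y ∂μ|} ≤ 2 * exp (-(n * t ^ 2 / 4096)) := by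
  have h1 := measureReal_sum_ge_le hind hlaw hY hg hB hgY hcosh hY1 ht0 ht1
  have h2 := measureReal_sum_ge_le hind hlaw hY hg.neg hB (g := fun x => -g x)
    (fun x => by rw [abs_neg]; exact hgY x) hcosh hY1 ht0 ht1
  refine (measureReal_mono (s₂ := {ω | n * t ≤ ∑ i, (g (ψ i ω) - ∫ y, g y ∂μ)} ∪
    {ω | n * t ≤ ∑ i, (-g (ψ i ω) - ∫ y, -g y ∂μ)}) fun ω hω => ?_).trans
    ((measureReal_union_le _ _).trans (by linarith))
  simp only [Set.mem_union, Set.mem_ofPred_eq, Finset.sum_sub_distrib, Finset.sum_neg_distrib,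
    integral_neg, Finset.sum_const, Finset.card_univ, Fintype.card_fin, nsmul_eq_mul] at hω ⊢
  rcases le_abs.1 hω with h | h
  · exact Or.inl h
  · right; linarith

end Concentration

end RandomPOVM
end

noncomputable section

namespace RandomPOVM

open MeasureTheory Metric Module

/-! ### Nets in finite-dimensional normed spaces -/

section Net

variable {V : Type*} [NormedAddCommGroup V] [NormedSpace ℝ V] [FiniteDimensional ℝ V]

/-- Volumetric bound on the cardinality of a separated subset of the unit ball. -/
theorem card_le_of_separated {δ : ℝ} (hδ : 0 < δ) (s : Finset V) (hs : ∀ c ∈ s, ‖c‖ ≤ 1)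
    (h : ∀ c ∈ s, ∀ e ∈ s, c ≠ e → δ ≤ ‖c - e‖) :
    (s.card : ℝ) ≤ (1 + 2 / δ) ^ finrank ℝ V := by
  borelize V
  let μ : Measure V := Measure.addHaar
  set ρ : ℝ := 1 + δ / 2 with hρ
  have ρpos : 0 < ρ := by positivity
  have D : Set.Pairwise (s : Set V) (Function.onFun Disjoint fun c => ball (c : V) (δ / 2)) := by
    rintro c hc e he hce
    apply ball_disjoint_ball
    rw [dist_eq_norm]
    linarith [h c hc e he hce]
  have A_subset : (⋃ c ∈ s, ball (c : V) (δ / 2)) ⊆ ball (0 : V) ρ := by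
    refine Set.iUnion₂_subset fun x hx => ?_
    apply ball_subset_ball'
    rw [dist_zero_right]
    linarith [hs x hx]
  have I : (s.card : ENNReal) * ENNReal.ofReal ((δ / 2) ^ finrank ℝ V) * μ (ball 0 1) ≤
      ENNReal.ofReal (ρ ^ finrank ℝ V) * μ (ball 0 1) :=
    calc
      _ = μ (⋃ c ∈ s, ball (c : V) (δ / 2)) := by
        rw [measure_biUnion_finset D fun c _ => measurableSet_ball]
        simp only [μ.addHaar_ball_of_pos _ (half_pos hδ), Finset.sum_const, nsmul_eq_mul, mul_assoc]
      _ ≤ μ (ball (0 : V) ρ) := measure_mono A_subset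
      _ = _ := by rw [μ.addHaar_ball_of_pos _ ρpos]
  have J := (ENNReal.mul_le_mul_iff_left (measure_ball_pos _ _ zero_lt_one).ne'
    measure_ball_lt_top.ne).1 I
  have K := ENNReal.toReal_le_of_le_ofReal (pow_nonneg ρpos.le _) J
  rw [ENNReal.toReal_mul, ENNReal.toReal_natCast, ENNReal.toReal_ofReal (by positivity)] at K
  have e : (1 + 2 / δ) = ρ / (δ / 2) := by
    rw [hρ]
    field_simp
    ring
  rw [e, div_pow, le_div_iff₀ (by positivity)]
  exact K

/-- Every subset of the unit ball has a `δ`-net of controlled cardinality. -/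
theorem exists_net {δ : ℝ} (hδ : 0 < δ) (A : Set V) (hA : ∀ x ∈ A, ‖x‖ ≤ 1) :
    ∃ s : Finset V, (∀ x ∈ s, x ∈ A) ∧ (s.card : ℝ) ≤ (1 + 2 / δ) ^ finrank ℝ V ∧
      ∀ x ∈ A, ∃ y ∈ s, ‖x - y‖ < δ := by
  classical
  -- If no net existed, every separated set within the volumetric bound would miss some point of `A`
  -- by `δ` and could be enlarged, giving separated sets of every size.
  by_contra! hcon
  have key : ∀ m : ℕ, ∃ s : Finset V, s.card = m ∧ (∀ x ∈ s, x ∈ A) ∧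
      ∀ c ∈ s, ∀ e ∈ s, c ≠ e → δ ≤ ‖c - e‖ := by
    intro m
    induction m with
    | zero => exact ⟨∅, by simp⟩
    | succ m ih =>
      obtain ⟨s, hc, hsA, hsep⟩ := ih
      obtain ⟨x, hxA, hx⟩ := hcon s hsA (card_le_of_separated hδ s (fun c hc => hA c (hsA c hc)) hsep)
      have hxs : x ∉ s := fun hxs => by
        have := hx x hxs
        rw [sub_self, norm_zero] at this
        linarith
      refine ⟨insert x s, by rw [Finset.card_insert_of_notMem hxs, hc], ?_, ?_⟩
      · intro y hy
        rcases Finset.mem_insert.1 hy with rfl | hy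
        · exact hxA
        · exact hsA y hy
      · intro c hc e he hce
        rcases Finset.mem_insert.1 hc with rfl | hc' <;>
          rcases Finset.mem_insert.1 he with rfl | he'
        · exact absurd rfl hce
        · exact hx e he'
        · rw [norm_sub_rev]; exact hx c hc'
        · exact hsep c hc' e he' hce
  obtain ⟨N, hN⟩ := exists_nat_gt ((1 + 2 / δ) ^ finrank ℝ V)
  obtain ⟨s, hc, hsA, hsep⟩ := key N
  have := card_le_of_separated hδ s (fun c hc => hA c (hsA c hc)) hsep
  rw [hc] at this
  linarith

end Net

end RandomPOVM
end

noncomputable section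

namespace RandomPOVM

open Matrix
open scoped MatrixOrder ComplexOrder

/-! ### Perturbation of the identity in Frobenius norm -/

section Frobenius

attribute [local instance] Matrix.frobeniusNormedRing Matrix.frobeniusNormedAlgebra

variable {d : ℕ}

theorem frobenius_norm_sq (A : Matrix (Fin d) (Fin d) ℂ) : ‖A‖ ^ 2 = ∑ i, ∑ j, ‖A i j‖ ^ 2 := by
  rw [Matrix.frobenius_norm_def, ← Real.rpow_natCast, ← Real.rpow_mul (by positivity)]
  norm_num

theorem frobenius_norm_sq_eq_trace (A : Matrix (Fin d) (Fin d) ℂ) :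
    ‖A‖ ^ 2 = (A * Aᴴ).trace.re := by
  rw [← sum_norm_sq_eq_trace, Complex.ofReal_re, frobenius_norm_sq]

theorem traceNorm₂_sq_eq (A : Matrix (Fin d) (Fin d) ℂ) :
    traceNorm₂ A ^ 2 = ‖A.trace‖ ^ 2 + ‖A‖ ^ 2 := by
  rw [traceNorm₂_sq, frobenius_norm_sq]

theorem norm_trace_mul_le (A B : Matrix (Fin d) (Fin d) ℂ) : ‖(A * B).trace‖ ≤ ‖A‖ * ‖B‖ := by
  have h1 : ‖(A * B).trace‖ ≤ ∑ p : Fin d × Fin d, ‖A p.1 p.2‖ * ‖B p.2 p.1‖ := by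
    simp only [Matrix.trace, Matrix.diag_apply, Matrix.mul_apply]
    rw [← Fintype.sum_prod_type']
    exact (norm_sum_le _ _).trans (le_of_eq (by simp only [norm_mul]))
  have h2 := Finset.sum_mul_sq_le_sq_mul_sq Finset.univ
    (fun p : Fin d × Fin d => ‖A p.1 p.2‖) fun p => ‖B p.2 p.1‖
  rw [Fintype.sum_prod_type' (fun i j => ‖A i j‖ ^ 2),
    Fintype.sum_prod_type' (fun i j => ‖B j i‖ ^ 2), Finset.sum_comm (f := fun i j => ‖B j i‖ ^ 2),
    ← frobenius_norm_sq, ← frobenius_norm_sq, ← mul_pow] at h2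
  exact h1.trans (abs_le_of_sq_le_sq' h2 (by positivity)).2

/-- With `B = A - 1`, one has `A² - 1 = B + BA`, whose squared norm is `‖B‖² + ‖BA‖² + 2 tr (BAB)`,
and the last trace is nonnegative because `A` is positive. -/
theorem norm_sub_one_le_norm_sq_sub_one {A : Matrix (Fin d) (Fin d) ℂ} (hA : A.PosSemidef) :
    ‖A - 1‖ ≤ ‖A * A - 1‖ := by
  have hB : (A - 1).IsHermitian := hA.isHermitian.sub Matrix.isHermitian_one
  set B := A - 1 with hBdef
  have e1 : A * A - 1 = B + B * A := by rw [hBdef]; noncomm_ring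
  have e2 : (B + B * A)ᴴ = B + A * B := by
    rw [conjTranspose_add, conjTranspose_mul, hB.eq, hA.isHermitian.eq]
  have hp : 0 ≤ (B * A * B).trace.re := by
    have := (hA.mul_mul_conjTranspose_same B).trace_nonneg
    rw [hB.eq] at this
    exact (Complex.le_def.1 this).1
  have h1 := frobenius_norm_sq_eq_trace (B + B * A)
  have h2 := frobenius_norm_sq_eq_trace B
  have h3 := frobenius_norm_sq_eq_trace (B * A)
  rw [hB.eq] at h2
  rw [conjTranspose_mul, hB.eq, hA.isHermitian.eq] at h3
  have e3 : (B + B * A) * (B + A * B) = B * B + B * A * (A * B) + (B * A * B + B * A * B) := by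
    noncomm_ring
  rw [e2, e3, trace_add, trace_add, trace_add, Complex.add_re, Complex.add_re, Complex.add_re] at h1
  rw [e1]
  refine le_of_sq_le_sq ?_ (norm_nonneg _)
  nlinarith [sq_nonneg ‖B * A‖]

theorem isUnit_of_norm_sub_one_lt_one {A : Matrix (Fin d) (Fin d) ℂ} (h : ‖A - 1‖ < 1) :
    IsUnit A := by
  have : CompleteSpace (Matrix (Fin d) (Fin d) ℂ) := FiniteDimensional.complete ℂ _
  have := isUnit_one_sub_of_norm_lt_one (x := 1 - A) (by rwa [norm_sub_rev])
  simpa using this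

/-- The Frobenius norm of `1` is `√d`, so `‖A⁻¹‖` must not enter. The unknown `x = ‖A⁻¹ - 1‖`
satisfies `x ≤ a x + a` instead, which is free of the dimension. -/
theorem norm_inv_sub_one_le {A : Matrix (Fin d) (Fin d) ℂ} {a : ℝ} (h : ‖A - 1‖ ≤ a)
    (ha : a ≤ 1 / 4) : ‖A⁻¹ - 1‖ ≤ 2 * a := by
  have hu := isUnit_of_norm_sub_one_lt_one (A := A) (by linarith)
  have hi : A * A⁻¹ = 1 := Matrix.mul_nonsing_inv A ((Matrix.isUnit_iff_isUnit_det A).1 hu)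
  have e : A⁻¹ - 1 = -((A - 1) * (A⁻¹ - 1)) - (A - 1) := by
    have : (A - 1) * (A⁻¹ - 1) = A * A⁻¹ - A - A⁻¹ + 1 := by noncomm_ring
    rw [this, hi]
    abel
  have h1 : ‖A⁻¹ - 1‖ ≤ ‖A - 1‖ * ‖A⁻¹ - 1‖ + ‖A - 1‖ := by
    conv_lhs => rw [e]
    refine (norm_sub_le _ _).trans ?_
    rw [norm_neg]
    gcongr
    exact norm_mul_le _ _
  nlinarith [norm_nonneg (A⁻¹ - 1), norm_nonneg (A - 1)]

/-- The trace of the difference is `tr (Δ (R² - 1))`, and Cauchy–Schwarz bounds it by Frobenius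
norms. Closeness of `R` to `1` in operator norm would not control this term without a dimensional
loss. -/
theorem traceNorm₂_mul_mul_sub_le (Δ : Matrix (Fin d) (Fin d) ℂ) {R : Matrix (Fin d) (Fin d) ℂ}
    {η : ℝ} (h : ‖R - 1‖ ≤ η) :
    traceNorm₂ (R * Δ * R - Δ) ≤ 2 * (2 * η + η ^ 2) * traceNorm₂ Δ := by
  set T := R - 1
  have hη : 0 ≤ η := (norm_nonneg _).trans h
  have e1 : R * Δ * R - Δ = T * Δ * T + T * Δ + Δ * T := by simp only [T]; noncomm_ring
  have e2 : (R * Δ * R - Δ).trace = (Δ * (T * T + T + T)).trace := by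
    have : Δ * (T * T + T + T) = Δ * (R * R) - Δ := by simp only [T]; noncomm_ring
    rw [this, trace_sub, trace_sub, mul_assoc, trace_mul_comm, mul_assoc]
  have hTT : ‖T * T‖ ≤ η ^ 2 := (norm_mul_le _ _).trans (by rw [sq]; gcongr)
  have h1 : ‖R * Δ * R - Δ‖ ≤ (2 * η + η ^ 2) * ‖Δ‖ := by
    rw [e1]
    calc _ ≤ ‖T * Δ * T‖ + ‖T * Δ‖ + ‖Δ * T‖ := norm_add₃_le
      _ ≤ ‖T‖ * ‖Δ‖ * ‖T‖ + ‖T‖ * ‖Δ‖ + ‖Δ‖ * ‖T‖ := by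
        gcongr
        · exact (norm_mul_le _ _).trans (by gcongr; exact norm_mul_le _ _)
        · exact norm_mul_le _ _
        · exact norm_mul_le _ _
      _ ≤ η * ‖Δ‖ * η + η * ‖Δ‖ + ‖Δ‖ * η := by gcongr
      _ = _ := by ring
  have h2 : ‖(R * Δ * R - Δ).trace‖ ≤ (2 * η + η ^ 2) * ‖Δ‖ := by
    rw [e2]
    refine (norm_trace_mul_le _ _).trans ?_
    rw [mul_comm]
    gcongr
    calc _ ≤ ‖T * T‖ + ‖T‖ + ‖T‖ := norm_add₃_le
      _ ≤ η ^ 2 + η + η := by gcongr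
      _ = _ := by ring
  have h3 : ‖Δ‖ ≤ traceNorm₂ Δ := by
    refine le_of_sq_le_sq ?_ (traceNorm₂_nonneg _)
    rw [traceNorm₂_sq_eq]
    linarith [sq_nonneg ‖Δ.trace‖]
  have h4 : traceNorm₂ (R * Δ * R - Δ) ≤ 2 * ((2 * η + η ^ 2) * ‖Δ‖) := by
    refine le_of_sq_le_sq ?_ (by positivity)
    rw [traceNorm₂_sq_eq]
    have i1 := pow_le_pow_left₀ (norm_nonneg _) h1 2
    have i2 := pow_le_pow_left₀ (norm_nonneg _) h2 2
    nlinarith [sq_nonneg ((2 * η + η ^ 2) * ‖Δ‖)]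
  refine h4.trans ?_
  rw [← mul_assoc]
  gcongr

/-- A traceless Hermitian matrix is controlled by the functional it induces. -/
theorem norm_le_of_re_trace_mul_le {H : Matrix (Fin d) (Fin d) ℂ} (hH : H.IsHermitian)
    (htr : H.trace = 0) {e : ℝ} (he : 0 ≤ e)
    (h : (H * H).trace.re ≤ e * traceNorm₂ H) : ‖H‖ ≤ e := by
  have h1 := frobenius_norm_sq_eq_trace H
  rw [hH.eq] at h1
  have h2 := traceNorm₂_sq_eq H
  rw [htr, norm_zero] at h2
  have h3 : traceNorm₂ H = ‖H‖ := by
    rw [← sq_eq_sq₀ (traceNorm₂_nonneg _) (norm_nonneg _), h2]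
    ring
  rw [h3, ← h1] at h
  by_contra! hc
  nlinarith

/-- If the square of a positive matrix `A` is close to `1`, then conjugation by `A⁻¹` is close to
the identity. -/
theorem traceNorm₂_inv_mul_mul_inv_sub_le {A : Matrix (Fin d) (Fin d) ℂ} (hA : A.PosSemidef)
    {e : ℝ} (he : 0 ≤ e) (he4 : e ≤ 1 / 4) (htr : (A * A - 1).trace = 0)
    (h : ((A * A - 1) * (A * A - 1)).trace.re ≤ e * traceNorm₂ (A * A - 1)) :
    IsUnit A ∧ ∀ Δ, traceNorm₂ (A⁻¹ * Δ * A⁻¹ - Δ) ≤ 10 * e * traceNorm₂ Δ := by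
  have hH : (A * A - 1).IsHermitian := by
    have : (A * A).IsHermitian := by
      rw [Matrix.IsHermitian, conjTranspose_mul, hA.isHermitian.eq]
    exact this.sub isHermitian_one
  have h1 := (norm_sub_one_le_norm_sq_sub_one hA).trans (norm_le_of_re_trace_mul_le hH htr he h)
  refine ⟨isUnit_of_norm_sub_one_lt_one (h1.trans_lt (by linarith)), fun Δ => ?_⟩
  refine (traceNorm₂_mul_mul_sub_le Δ (norm_inv_sub_one_le h1 he4)).trans ?_
  refine mul_le_mul_of_nonneg_right ?_ (traceNorm₂_nonneg _)
  -- For `η = 2e` the factor is `8e + 8e²`, at most `10e` since `e ≤ 1/4`.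
  nlinarith

end Frobenius

end RandomPOVM
end

noncomputable section

namespace RandomPOVM

open Matrix MeasureTheory
open scoped MatrixOrder ComplexOrder

/-! ### From uniform closeness of empirical means to the normalized POVM -/

section Deterministic

variable {d n : ℕ}

theorem trace_mul_proj (A : Matrix (Fin d) (Fin d) ℂ) (ψ : UnitSphere d) :
    (A * proj ψ).trace = star (coords ψ) ⬝ᵥ A.mulVec (coords ψ) := by
  rw [proj, mul_vecMulVec, trace_vecMulVec, dotProduct_comm]

theorem trace_mul_proj_eq_quadForm {A : Matrix (Fin d) (Fin d) ℂ} (hA : A.IsHermitian)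
    (ψ : UnitSphere d) : (A * proj ψ).trace = (quadForm A ψ : ℂ) := by
  rw [trace_mul_proj]
  exact star_dotProduct_mulVec_eq_quadForm hA _

theorem posSemidef_proj (ψ : UnitSphere d) : (proj ψ).PosSemidef :=
  posSemidef_vecMulVec_self_star _

theorem trace_proj (ψ : UnitSphere d) : (proj ψ).trace = 1 := by
  have h : ‖(ψ : EuclideanSpace ℂ (Fin d))‖ = 1 := norm_eq_of_mem_sphere ψ
  have h2 : inner ℂ (ψ : EuclideanSpace ℂ (Fin d)) ψ = 1 := by
    rw [inner_self_eq_norm_sq_to_K, h]; simp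
  rw [proj, trace_vecMulVec, ← h2, EuclideanSpace.inner_eq_star_dotProduct]
  rfl

theorem posSemidef_frameSum (ψ : Fin n → UnitSphere d) : (frameSum ψ).PosSemidef :=
  posSemidef_sum _ fun i _ => posSemidef_proj (ψ i)

theorem trace_frameSum (ψ : Fin n → UnitSphere d) : (frameSum ψ).trace = n := by
  rw [frameSum, trace_sum]
  simp [trace_proj]

theorem trace_mul_frameSum {A : Matrix (Fin d) (Fin d) ℂ} (hA : A.IsHermitian)
    (ψ : Fin n → UnitSphere d) :
    (A * frameSum ψ).trace = ((∑ i, quadForm A (ψ i) : ℝ) : ℂ) := by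
  rw [frameSum, Finset.mul_sum, trace_sum]
  simp [trace_mul_proj_eq_quadForm hA]

theorem uniformNorm_eq {Δ : Matrix (Fin d) (Fin d) ℂ} (hΔ : Δ.IsHermitian) :
    uniformNorm d Δ = d * ∫ ψ, |quadForm Δ ψ| ∂(uniformSphere d) := by
  rw [uniformNorm]
  congr 2
  ext ψ
  rw [coords, star_dotProduct_mulVec_eq_quadForm hΔ, Complex.norm_real, Real.norm_eq_abs]

theorem quadForm_real_smul (c : ℝ) (A : Matrix (Fin d) (Fin d) ℂ) (z : EuclideanSpace ℂ (Fin d)) :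
    quadForm (c • A) z = c * quadForm A z := by
  simp [quadForm, smul_mulVec]

theorem quadForm_sub (A B : Matrix (Fin d) (Fin d) ℂ) (z : EuclideanSpace ℂ (Fin d)) :
    quadForm (A - B) z = quadForm A z - quadForm B z := by
  simp [quadForm, sub_mulVec]

theorem traceNorm₂_add_le (A B : Matrix (Fin d) (Fin d) ℂ) :
    traceNorm₂ (A + B) ≤ traceNorm₂ A + traceNorm₂ B := by
  rw [traceNorm₂, map_add]
  exact norm_add_le _ _

theorem traceNorm₂_real_smul (c : ℝ) (A : Matrix (Fin d) (Fin d) ℂ) :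
    traceNorm₂ (c • A) = |c| * traceNorm₂ A := by
  have : c • A = (c : ℂ) • A := by ext i j; simp
  rw [traceNorm₂, this, map_smul, norm_smul, Complex.norm_real, Real.norm_eq_abs, traceNorm₂]

theorem uniformNorm_sub_le [NeZero d] {A B : Matrix (Fin d) (Fin d) ℂ} (hA : A.IsHermitian)
    (hB : B.IsHermitian) : |uniformNorm d A - uniformNorm d B| ≤ uniformNorm d (A - B) := by
  have hi : ∀ M : Matrix (Fin d) (Fin d) ℂ,
      Integrable (fun ψ : UnitSphere d => |quadForm M ψ|) (uniformSphere d) := fun M =>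
    integrable_of_continuous_sphere (continuous_quadForm_sphere M).abs
  rw [uniformNorm_eq hA, uniformNorm_eq hB, uniformNorm_eq (hA.sub hB), ← mul_sub, abs_mul,
    Nat.abs_cast, ← integral_sub (hi A) (hi B)]
  gcongr
  refine abs_integral_le_integral_abs.trans
    (integral_mono ((hi A).sub (hi B)).abs (hi _) fun ψ => ?_)
  simp only [quadForm_sub]
  exact abs_abs_sub_abs_le _ _

/-- If the empirical means of `|⟨ψ_i|Δ|ψ_i⟩|` and `⟨ψ_i|Δ|ψ_i⟩` are uniformly close to their
expectations, then the normalized family is a POVM whose norm is close to `uniformNorm`. -/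
theorem randomPOVM_of_close [NeZero d] (hn : 0 < n) (ψ : Fin n → UnitSphere d) {e : ℝ}
    (he : 0 ≤ e) (he4 : e ≤ 1 / 4)
    (hU : ∀ Δ : Matrix (Fin d) (Fin d) ℂ, Δ.IsHermitian → uniformNorm d Δ ≤ traceNorm₂ Δ)
    (h1 : ∀ Δ : Matrix (Fin d) (Fin d) ℂ, Δ.IsHermitian →
      |(d / n : ℝ) * ∑ i, |quadForm Δ (ψ i)| - uniformNorm d Δ| ≤ e * traceNorm₂ Δ)
    (h2 : ∀ Δ : Matrix (Fin d) (Fin d) ℂ, Δ.IsHermitian →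
      |(d / n : ℝ) * ∑ i, quadForm Δ (ψ i) - Δ.trace.re| ≤ e * traceNorm₂ Δ) :
    IsDiscretePOVM (randomPOVM ψ) ∧ ∀ Δ : Matrix (Fin d) (Fin d) ℂ, Δ.IsHermitian →
      |povmNorm (randomPOVM ψ) Δ - uniformNorm d Δ| ≤ 15 * e * traceNorm₂ Δ := by
  have hd : (0 : ℝ) < d := by exact_mod_cast Nat.pos_of_ne_zero (NeZero.ne d)
  have hn' : (0 : ℝ) < n := by exact_mod_cast hn
  set S := frameSum ψ with hS
  have hSp : S.PosSemidef := posSemidef_frameSum ψ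
  set Q := CFC.sqrt S with hQ
  have hQp : Q.PosSemidef := Matrix.nonneg_iff_posSemidef.1 (CFC.sqrt_nonneg S)
  have hQQ : Q * Q = S := CFC.sqrt_mul_sqrt_self S (Matrix.nonneg_iff_posSemidef.2 hSp)
  set c : ℝ := Real.sqrt (d / n) with hc
  have hc0 : 0 < c := Real.sqrt_pos.2 (by positivity)
  have hcc : c * c = d / n := Real.mul_self_sqrt (by positivity)
  set A := c • Q with hA
  have hAp : A.PosSemidef := hQp.smul hc0.le
  have hAA : A * A = (d / n : ℝ) • S := by
    rw [hA, smul_mul_smul_comm, hQQ, hcc]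
  have hH : (A * A - 1).IsHermitian := by
    have : (A * A).IsHermitian := by
      rw [Matrix.IsHermitian, conjTranspose_mul, hAp.isHermitian.eq]
    exact this.sub isHermitian_one
  have htr : (A * A - 1).trace = 0 := by
    rw [hAA, trace_sub, trace_smul, trace_frameSum, trace_one, Fintype.card_fin,
      Complex.real_smul]
    have : (n : ℂ) ≠ 0 := by exact_mod_cast hn.ne'
    push_cast
    field_simp
    simp
  -- The trace estimate `h2` is applied to `H = A² - 1` itself: its empirical mean is `tr (H A²) =
  -- tr H² + tr H`.
  have hHH : ((A * A - 1) * (A * A - 1)).trace.re ≤ e * traceNorm₂ (A * A - 1) := by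
    refine le_trans (le_of_eq ?_) ((le_abs_self _).trans (h2 _ hH))
    have : ((A * A - 1) * (A * A - 1)).trace
        = (((d / n : ℝ) * ∑ i, quadForm (A * A - 1) (ψ i) : ℝ) : ℂ) - (A * A - 1).trace := by
      conv_lhs => rw [mul_sub, mul_one]
      rw [trace_sub]
      conv_lhs => enter [1, 1, 2]; rw [hAA]
      rw [mul_smul_comm, trace_smul, trace_mul_frameSum hH, Complex.real_smul, Complex.ofReal_mul]
    rw [this, Complex.sub_re, Complex.ofReal_re]
  obtain ⟨hAu, hclose⟩ := traceNorm₂_inv_mul_mul_inv_sub_le hAp he he4 htr hHH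
  have hQu : IsUnit Q := by
    have : Q = c⁻¹ • A := by rw [hA, smul_smul, inv_mul_cancel₀ hc0.ne', one_smul]
    rw [this]
    exact hAu.smul (Units.mk0 c⁻¹ (inv_ne_zero hc0.ne'))
  have hQdet := (Matrix.isUnit_iff_isUnit_det Q).1 hQu
  have hRh : (Q⁻¹).IsHermitian := hQp.isHermitian.inv
  have hAinv : A⁻¹ = c⁻¹ • Q⁻¹ := by
    apply Matrix.inv_eq_right_inv
    rw [hA, smul_mul_smul_comm, mul_inv_cancel₀ hc0.ne', one_smul, Matrix.mul_nonsing_inv Q hQdet]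
  have hM : ∀ i, randomPOVM ψ i = Q⁻¹ * proj (ψ i) * Q⁻¹ := fun i => rfl
  refine ⟨⟨fun i => ?_, ?_⟩, fun Δ hΔ => ?_⟩
  · rw [hM]
    have := (posSemidef_proj (ψ i)).mul_mul_conjTranspose_same Q⁻¹
    rwa [hRh.eq] at this
  · simp only [hM]
    rw [← Finset.sum_mul, ← Finset.mul_sum]
    change Q⁻¹ * S * Q⁻¹ = 1
    rw [← hQQ, ← mul_assoc, Matrix.nonsing_inv_mul Q hQdet, one_mul, Matrix.mul_nonsing_inv Q hQdet]
  · have hconj : ∀ R : Matrix (Fin d) (Fin d) ℂ, R.IsHermitian → (R * Δ * R).IsHermitian := by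
      intro R hR
      have := isHermitian_mul_mul_conjTranspose R hΔ
      rwa [hR.eq] at this
    set Δ' := A⁻¹ * Δ * A⁻¹ with hΔ'
    have hΔ'h : Δ'.IsHermitian := hconj _ hAp.isHermitian.inv
    have e1 : Δ' = (n / d : ℝ) • (Q⁻¹ * Δ * Q⁻¹) := by
      rw [hΔ', hAinv, smul_mul_assoc, smul_mul_smul_comm, ← mul_inv, hcc, inv_div]
    -- By cyclicity of the trace, conjugating `P_i` amounts to conjugating `Δ`, so the POVM norm is
    -- an unnormalized-family mean at `Δ'` and `h1` applies to it.
    have e2 : povmNorm (randomPOVM ψ) Δ = (d / n : ℝ) * ∑ i, |quadForm Δ' (ψ i)| := by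
      rw [povmNorm, Finset.mul_sum]
      refine Finset.sum_congr rfl fun i _ => ?_
      have hcancel : ∀ x : ℝ, (d / n : ℝ) * ((n / d : ℝ) * x) = x := fun x => by field_simp
      rw [hM, e1, quadForm_real_smul, abs_mul, abs_of_pos (by positivity : (0 : ℝ) < n / d),
        hcancel, ← mul_assoc, trace_mul_comm, ← mul_assoc, ← mul_assoc,
        trace_mul_proj_eq_quadForm (hconj _ hRh), Complex.norm_real, Real.norm_eq_abs]
    have hs := hclose Δ
    have i1 := h1 Δ' hΔ'h
    have i2 := (uniformNorm_sub_le hΔ'h hΔ).trans (hU _ (hΔ'h.sub hΔ))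
    have i3 : traceNorm₂ Δ' ≤ traceNorm₂ (Δ' - Δ) + traceNorm₂ Δ := by
      simpa using traceNorm₂_add_le (Δ' - Δ) Δ
    have h0 := traceNorm₂_nonneg Δ
    rw [e2]
    calc _ ≤ |(d / n : ℝ) * ∑ i, |quadForm Δ' (ψ i)| - uniformNorm d Δ'| +
          |uniformNorm d Δ' - uniformNorm d Δ| := abs_sub_le _ _ _
      _ ≤ e * (10 * e * traceNorm₂ Δ + traceNorm₂ Δ) + 10 * e * traceNorm₂ Δ :=
        add_le_add (i1.trans (by gcongr; linarith)) (i2.trans hs)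
      _ ≤ 15 * e * traceNorm₂ Δ := by
        nlinarith [mul_nonneg he h0, mul_nonneg (mul_nonneg he h0) (sub_nonneg.2 he4)]

end Deterministic

end RandomPOVM
end

noncomputable section

namespace RandomPOVM

open MeasureTheory ProbabilityTheory Real
open scoped MatrixOrder ComplexOrder

/-! ### Homogeneity and equivalence of `uniformNorm` with `traceNorm₂` -/

section Homogeneity

variable {d : ℕ}

theorem uniformNorm_real_smul (c : ℝ) {Δ : Matrix (Fin d) (Fin d) ℂ} (hΔ : Δ.IsHermitian) :
    uniformNorm d (c • Δ) = |c| * uniformNorm d Δ := by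
  have hc : (c • Δ).IsHermitian := IsSelfAdjoint.smul (IsSelfAdjoint.all c) hΔ
  rw [uniformNorm_eq hc, uniformNorm_eq hΔ]
  simp only [quadForm_real_smul, abs_mul, integral_const_mul]
  ring

theorem uniformNorm_eq_integral_abs {Δ : Matrix (Fin d) (Fin d) ℂ} (hΔ : Δ.IsHermitian) :
    uniformNorm d Δ = ∫ ψ, |d * quadForm Δ ψ| ∂(uniformSphere d) := by
  rw [uniformNorm_eq hΔ]
  simp only [abs_mul, Nat.abs_cast, integral_const_mul]

theorem eq_zero_of_traceNorm₂_eq_zero {Δ : Matrix (Fin d) (Fin d) ℂ} (h : traceNorm₂ Δ = 0) :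
    Δ = 0 := by
  rw [traceNorm₂, norm_eq_zero] at h
  ext i j
  have := congrArg (fun v => v.ofLp (some (i, j))) h
  simpa [entriesTrace] using this

/-- Extension of a homogeneous inequality from the unit sphere of `traceNorm₂`. -/
theorem forall_isHermitian_of_unit {f : Matrix (Fin d) (Fin d) ℂ → ℝ} {K : ℝ}
    (hf : ∀ Δ : Matrix (Fin d) (Fin d) ℂ, Δ.IsHermitian → ∀ c : ℝ, 0 ≤ c → f (c • Δ) = c * f Δ)
    (h : ∀ Δ : Matrix (Fin d) (Fin d) ℂ, Δ.IsHermitian → traceNorm₂ Δ = 1 → f Δ ≤ K)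
    {Δ : Matrix (Fin d) (Fin d) ℂ} (hΔ : Δ.IsHermitian) : f Δ ≤ K * traceNorm₂ Δ := by
  rcases (traceNorm₂_nonneg Δ).eq_or_lt with h0 | h0
  · have hz := eq_zero_of_traceNorm₂_eq_zero h0.symm
    have := hf Δ hΔ 0 le_rfl
    rw [zero_smul, zero_mul] at this
    rw [← h0, hz, this, mul_zero]
  · set s := traceNorm₂ Δ
    have hh : (s⁻¹ • Δ).IsHermitian := IsSelfAdjoint.smul (IsSelfAdjoint.all _) hΔ
    have h1 := h (s⁻¹ • Δ) hh (by
      rw [traceNorm₂_real_smul, abs_of_pos (inv_pos.2 h0), inv_mul_cancel₀ h0.ne'])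
    rw [hf Δ hΔ _ (inv_pos.2 h0).le, inv_mul_le_iff₀ h0] at h1
    linarith

theorem abs_re_trace_le (Δ : Matrix (Fin d) (Fin d) ℂ) : |Δ.trace.re| ≤ traceNorm₂ Δ := by
  refine (Complex.abs_re_le_norm _).trans (le_of_sq_le_sq ?_ (traceNorm₂_nonneg _))
  rw [traceNorm₂_sq]
  linarith [show 0 ≤ ∑ i, ∑ j, ‖Δ i j‖ ^ 2 by positivity]

theorem pow_four_le_cosh (x : ℝ) : x ^ 4 ≤ 48 * cosh x := by
  have h := pow_div_factorial_le_exp |x| (abs_nonneg x) 4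
  rw [← cosh_abs, cosh_eq]
  have e : |x| ^ 4 = x ^ 4 := Even.pow_abs (by decide) x
  rw [e] at h
  norm_num [Nat.factorial] at h
  linarith [exp_pos (-|x|)]

end Homogeneity

section QuadFormBound

attribute [local instance] Matrix.frobeniusNormedRing Matrix.frobeniusNormedAlgebra

variable {d : ℕ}

/-- Only the finiteness of `K` matters: it starts the recursion in `close_of_close_on_net`, where
its contribution is contracted to zero. -/
theorem exists_abs_quadForm_le (ψ : UnitSphere d) :
    ∃ K : ℝ, ∀ Δ : Matrix (Fin d) (Fin d) ℂ, Δ.IsHermitian →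
      |quadForm Δ ψ| ≤ K * traceNorm₂ Δ := by
  refine ⟨‖proj ψ‖, fun Δ hΔ => ?_⟩
  have h := norm_trace_mul_le Δ (proj ψ)
  rw [trace_mul_proj_eq_quadForm hΔ, Complex.norm_real, Real.norm_eq_abs] at h
  have h3 : ‖Δ‖ ≤ traceNorm₂ Δ := by
    refine le_of_sq_le_sq ?_ (traceNorm₂_nonneg _)
    rw [traceNorm₂_sq_eq]
    linarith [sq_nonneg ‖Δ.trace‖]
  rw [mul_comm] at h
  exact h.trans (by gcongr)

end QuadFormBound

section UniformNorm

variable {d : ℕ} [NeZero d]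

theorem integral_sq_quadForm {Δ : Matrix (Fin d) (Fin d) ℂ} (hΔ : Δ.IsHermitian) :
    ∫ ψ, (d * quadForm Δ ψ) ^ 2 ∂(uniformSphere d) = d / (d + 1) * traceNorm₂ Δ ^ 2 := by
  have hd : (0 : ℝ) < d := by exact_mod_cast Nat.pos_of_ne_zero (NeZero.ne d)
  rw [← (sphere_moments hΔ).2.1]
  simp only [mul_pow, integral_const_mul]
  field_simp

theorem integral_abs_le_one {Δ : Matrix (Fin d) (Fin d) ℂ} (hΔ : Δ.IsHermitian)
    (hs : traceNorm₂ Δ ≤ 1) : ∫ ψ, |d * quadForm Δ ψ| ∂(uniformSphere d) ≤ 1 := by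
  have hd : (0 : ℝ) < d := by exact_mod_cast Nat.pos_of_ne_zero (NeZero.ne d)
  have hc : Continuous fun ψ : UnitSphere d => d * quadForm Δ ψ :=
    continuous_const.mul (continuous_quadForm_sphere Δ)
  have h2 : ∫ ψ, (d * quadForm Δ ψ) ^ 2 ∂(uniformSphere d) ≤ 1 := by
    rw [integral_sq_quadForm hΔ]
    have h1 : (d : ℝ) / (d + 1) ≤ 1 := by rw [div_le_one (by positivity)]; linarith
    have h2 : traceNorm₂ Δ ^ 2 ≤ 1 := (sq_le_one_iff₀ (traceNorm₂_nonneg Δ)).2 hs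
    exact mul_le_one₀ h1 (sq_nonneg _) h2
  have i2 : Integrable (fun ψ : UnitSphere d => (d * quadForm Δ ψ) ^ 2) (uniformSphere d) :=
    integrable_of_continuous_sphere (hc.pow 2)
  calc _ ≤ ∫ ψ, (1 + (d * quadForm Δ ψ) ^ 2) / 2 ∂(uniformSphere d) := by
        refine integral_mono (integrable_of_continuous_sphere hc.abs)
          (((integrable_const 1).add i2).div_const 2) fun ψ => ?_
        have := two_mul_le_add_sq 1 |d * quadForm Δ ψ|
        rw [sq_abs] at this
        simp only
        linarith
    _ = (1 + ∫ ψ, (d * quadForm Δ ψ) ^ 2 ∂(uniformSphere d)) / 2 := by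
        rw [integral_div, integral_add (integrable_const 1) i2]
        simp
    _ ≤ 1 := by linarith

theorem uniformNorm_le_traceNorm₂ {Δ : Matrix (Fin d) (Fin d) ℂ} (hΔ : Δ.IsHermitian) :
    uniformNorm d Δ ≤ traceNorm₂ Δ := by
  rw [← one_mul (traceNorm₂ Δ)]
  refine forall_isHermitian_of_unit (fun Δ hΔ c hc => ?_) (fun Δ hΔ hs => ?_) hΔ
  · rw [uniformNorm_real_smul c hΔ, abs_of_nonneg hc]
  · rw [uniformNorm_eq_integral_abs hΔ]
    exact integral_abs_le_one hΔ hs.le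

/-- For `traceNorm₂ Δ = 1` the second moment of `d q` is at least `1/2`, and the `cosh` moment
prevents it from being carried by large values, so the first moment is bounded below. -/
theorem traceNorm₂_le_uniformNorm {Δ : Matrix (Fin d) (Fin d) ℂ} (hΔ : Δ.IsHermitian) :
    traceNorm₂ Δ ≤ 300 * uniformNorm d Δ := by
  have key : -uniformNorm d Δ ≤ -(1 / 300) * traceNorm₂ Δ := by
    refine forall_isHermitian_of_unit (f := fun Δ => -uniformNorm d Δ)
      (fun Δ hΔ c hc => ?_) (fun Δ hΔ hs => ?_) hΔ
    · rw [uniformNorm_real_smul c hΔ, abs_of_nonneg hc]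
      ring
    · have hd : (1 : ℝ) ≤ d := by exact_mod_cast Nat.pos_of_ne_zero (NeZero.ne d)
      have hcs := (sphere_moments hΔ).2.2 hs.le
      have hsq := integral_sq_quadForm hΔ
      have hc : Continuous fun ψ : UnitSphere d => d * quadForm Δ ψ :=
        continuous_const.mul (continuous_quadForm_sphere Δ)
      have i1 := integrable_of_continuous_sphere hc.abs
      have i2 : Integrable (fun ψ : UnitSphere d => cosh (d * quadForm Δ ψ / 2))
        (uniformSphere d) :=
        integrable_of_continuous_sphere (continuous_cosh.comp (hc.div_const 2))
      -- For `|y| ≥ 100`, `y² ≤ y⁴ / 10⁴ ≤ 16 · 48 / 10⁴ · cosh (y / 2)`. Integrating leaves `1/2 ≤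
      -- 100 ‖Δ‖_U + 0.1536`, whence the factor `300`.
      have hpt : ∀ y : ℝ, y ^ 2 ≤ 100 * |y| + 768 / 10000 * cosh (y / 2) := by
        intro y
        have h4 := pow_four_le_cosh (y / 2)
        have e := sq_abs y
        have e4 : |y| ^ 4 = y ^ 4 := Even.pow_abs (by decide) y
        have h0 := abs_nonneg y
        rcases le_total |y| 100 with h | h
        · nlinarith [cosh_pos (y / 2)]
        · have : |y| ^ 2 * 100 ^ 2 ≤ |y| ^ 2 * |y| ^ 2 := by gcongr
          nlinarith
      have hle : ∫ ψ, (d * quadForm Δ ψ) ^ 2 ∂(uniformSphere d) ≤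
          100 * ∫ ψ, |d * quadForm Δ ψ| ∂(uniformSphere d) +
            768 / 10000 * ∫ ψ, cosh (d * quadForm Δ ψ / 2) ∂(uniformSphere d) := by
        rw [← integral_const_mul, ← integral_const_mul,
          ← integral_add (i1.const_mul _) (i2.const_mul _)]
        exact integral_mono (integrable_of_continuous_sphere (hc.pow 2))
          ((i1.const_mul _).add (i2.const_mul _)) fun ψ => hpt _
      have hhalf : (1 : ℝ) / 2 ≤ d / (d + 1) := by
        rw [div_le_div_iff₀ (by norm_num) (by positivity)]
        linarith
      rw [hsq, hs, ← uniformNorm_eq_integral_abs hΔ] at hle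
      linarith
  linarith

end UniformNorm

/-! ### Passing from a net to all Hermitian matrices -/

section NetArgument

variable {d n : ℕ} [NeZero d]

theorem exists_hermitian_net {δ : ℝ} (hδ : 0 < δ) :
    ∃ N : Finset (Matrix (Fin d) (Fin d) ℂ),
      (∀ Δ ∈ N, Δ.IsHermitian ∧ traceNorm₂ Δ ≤ 1) ∧
      (N.card : ℝ) ≤ (1 + 2 / δ) ^ (4 * d ^ 2) ∧
      ∀ Δ : Matrix (Fin d) (Fin d) ℂ, Δ.IsHermitian → traceNorm₂ Δ ≤ 1 →
        ∃ Δ' ∈ N, traceNorm₂ (Δ - Δ') < δ := by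
  classical
  obtain ⟨s, hsA, hcard, hnet⟩ := exists_net hδ
    (entriesTrace d '' {Δ | Δ.IsHermitian ∧ traceNorm₂ Δ ≤ 1}) (by
      rintro _ ⟨Δ, hΔ, rfl⟩
      exact hΔ.2)
  choose! g hg using hsA
  refine ⟨s.image g, ?_, ?_, ?_⟩
  · intro Δ hΔ
    obtain ⟨v, hv, rfl⟩ := Finset.mem_image.1 hΔ
    exact (hg v hv).1
  · refine (Nat.cast_le.2 Finset.card_image_le).trans (hcard.trans ?_)
    have h1 : (1 : ℝ) ≤ 1 + 2 / δ := by
      have : 0 ≤ 2 / δ := by positivity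
      linarith
    refine pow_le_pow_right₀ h1 ?_
    have hd : 1 ≤ d ^ 2 := Nat.one_le_pow _ _ (Nat.pos_of_ne_zero (NeZero.ne d))
    -- The real dimension of the whole ambient space is enough, as `2 (d² + 1) ≤ 4 d²` for `d ≥ 1`.
    have hfr : Module.finrank ℝ (EuclideanSpace ℂ (Option (Fin d × Fin d))) = 2 * (d * d + 1) := by
      rw [← Module.finrank_mul_finrank ℝ ℂ, Complex.finrank_real_complex, finrank_euclideanSpace]
      simp
    rw [hfr]
    nlinarith
  · intro Δ hΔ hs
    obtain ⟨v, hv, hlt⟩ := hnet _ ⟨Δ, ⟨hΔ, hs⟩, rfl⟩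
    refine ⟨g v, Finset.mem_image_of_mem g hv, ?_⟩
    rwa [traceNorm₂, map_sub, (hg v hv).2]

/-- Closeness of the empirical means on a net implies closeness everywhere. -/
theorem close_of_close_on_net {δ : ℝ} (hδ : 0 < δ) (hδ4 : δ ≤ 1 / 4)
    {N : Finset (Matrix (Fin d) (Fin d) ℂ)}
    (hN : ∀ Δ ∈ N, Δ.IsHermitian ∧ traceNorm₂ Δ ≤ 1)
    (hnet : ∀ Δ : Matrix (Fin d) (Fin d) ℂ, Δ.IsHermitian → traceNorm₂ Δ ≤ 1 →
      ∃ Δ' ∈ N, traceNorm₂ (Δ - Δ') < δ)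
    (ψ : Fin n → UnitSphere d)
    (h1 : ∀ Δ ∈ N, |(d / n : ℝ) * ∑ i, |quadForm Δ (ψ i)| - uniformNorm d Δ| ≤ δ)
    (h2 : ∀ Δ ∈ N, |(d / n : ℝ) * ∑ i, quadForm Δ (ψ i) - Δ.trace.re| ≤ δ)
    {Δ : Matrix (Fin d) (Fin d) ℂ} (hΔ : Δ.IsHermitian) :
    |(d / n : ℝ) * ∑ i, |quadForm Δ (ψ i)| - uniformNorm d Δ| ≤ 4 * δ * traceNorm₂ Δ ∧
      |(d / n : ℝ) * ∑ i, quadForm Δ (ψ i) - Δ.trace.re| ≤ 4 * δ * traceNorm₂ Δ := by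
  set E : Matrix (Fin d) (Fin d) ℂ → ℝ := fun Δ => (d / n : ℝ) * ∑ i, |quadForm Δ (ψ i)| with hE
  set F : Matrix (Fin d) (Fin d) ℂ → ℝ := fun Δ => (d / n : ℝ) * ∑ i, quadForm Δ (ψ i) with hF
  have hdn : (0 : ℝ) ≤ d / n := by positivity
  have hEF : ∀ Δ, |F Δ| ≤ E Δ := by
    intro Δ
    simp only [hE, hF]
    rw [abs_mul, abs_of_nonneg hdn]
    gcongr
    exact Finset.abs_sum_le_sum_abs _ _
  have hFs : ∀ A B, F A - F B = F (A - B) := by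
    intro A B
    simp only [hF, quadForm_sub, Finset.sum_sub_distrib]
    ring
  have hEs : ∀ A B, |E A - E B| ≤ E (A - B) := by
    intro A B
    simp only [hE]
    rw [← mul_sub, abs_mul, abs_of_nonneg hdn, ← Finset.sum_sub_distrib]
    gcongr
    refine (Finset.abs_sum_le_sum_abs _ _).trans (Finset.sum_le_sum fun i _ => ?_)
    rw [quadForm_sub]
    exact abs_abs_sub_abs_le _ _
  have hEc : ∀ Δ : Matrix (Fin d) (Fin d) ℂ, Δ.IsHermitian → ∀ c : ℝ, 0 ≤ c →
      E (c • Δ) = c * E Δ := by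
    intro Δ _ c hc
    simp only [hE, quadForm_real_smul, abs_mul, abs_of_nonneg hc, ← Finset.mul_sum]
    ring
  have hFc : ∀ Δ : Matrix (Fin d) (Fin d) ℂ, ∀ c : ℝ, F (c • Δ) = c * F Δ := by
    intro Δ c
    simp only [hF, quadForm_real_smul, ← Finset.mul_sum]
    ring
  -- An a priori bound on `E`, needed to control the error `E (Δ - Δ')` of net approximation. Each
  -- approximation divides the crude constant `K₀` by `4`, while the fixed part obeys `1 + δ + 2/4 ≤
  -- 2`; letting `k → ∞` removes `K₀`.
  have hE2 : ∀ Δ : Matrix (Fin d) (Fin d) ℂ, Δ.IsHermitian → E Δ ≤ 2 * traceNorm₂ Δ := by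
    choose K hK using fun i => exists_abs_quadForm_le (ψ i)
    set K₀ := (d / n : ℝ) * ∑ i, K i
    have hrec : ∀ k : ℕ, ∀ Δ : Matrix (Fin d) (Fin d) ℂ, Δ.IsHermitian →
        E Δ ≤ (2 + |K₀| * (1 / 4) ^ k) * traceNorm₂ Δ := by
      intro k
      induction k with
      | zero =>
        intro Δ hΔ
        have : E Δ ≤ K₀ * traceNorm₂ Δ := by
          simp only [hE, K₀]
          rw [mul_assoc, Finset.sum_mul]
          gcongr with i _
          exact hK i Δ hΔ
        refine this.trans (mul_le_mul_of_nonneg_right ?_ (traceNorm₂_nonneg _))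
        linarith [le_abs_self K₀]
      | succ k ih =>
        intro Δ hΔ
        refine forall_isHermitian_of_unit hEc (fun Δ hΔ hs => ?_) hΔ
        obtain ⟨Δ', hΔ', hlt⟩ := hnet Δ hΔ hs.le
        obtain ⟨hh', hs'⟩ := hN Δ' hΔ'
        have j1 := (abs_le.1 (h1 Δ' hΔ')).2
        have j2 := (uniformNorm_le_traceNorm₂ hh').trans hs'
        have j3 := (abs_le.1 (hEs Δ Δ')).2
        have j4 := ih (Δ - Δ') (hΔ.sub hh')
        have j5 : (2 + |K₀| * (1 / 4) ^ k) * traceNorm₂ (Δ - Δ') ≤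
            (2 + |K₀| * (1 / 4) ^ k) * (1 / 4) := by gcongr; linarith
        rw [pow_succ]
        linarith
    intro Δ hΔ
    refine ge_of_tendsto' (x := Filter.atTop) (f := fun k : ℕ =>
      (2 + |K₀| * (1 / 4) ^ k) * traceNorm₂ Δ) ?_ fun k => hrec k Δ hΔ
    have := ((tendsto_pow_atTop_nhds_zero_of_lt_one (by norm_num : (0 : ℝ) ≤ 1 / 4)
      (by norm_num)).const_mul |K₀|).const_add 2 |>.mul_const (traceNorm₂ Δ)
    simpa using this
  constructor
  · refine forall_isHermitian_of_unit (f := fun Δ => |E Δ - uniformNorm d Δ|)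
      (fun Δ hΔ c hc => ?_) (fun Δ hΔ hs => ?_) hΔ
    · rw [hEc Δ hΔ c hc, uniformNorm_real_smul c hΔ, abs_of_nonneg hc, ← mul_sub, abs_mul,
        abs_of_nonneg hc]
    -- The error `4δ` is `δ` at the net point, `2δ` from `E` and `δ` from `uniformNorm`.
    · obtain ⟨Δ', hΔ', hlt⟩ := hnet Δ hΔ hs.le
      have hh := hΔ.sub (hN Δ' hΔ').1
      have j1 := abs_le.1 (h1 Δ' hΔ')
      have j2 := abs_le.1 ((hEs Δ Δ').trans (hE2 _ hh))
      have j3 := abs_le.1 ((uniformNorm_sub_le hΔ (hN Δ' hΔ').1).trans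
        (uniformNorm_le_traceNorm₂ hh))
      rw [abs_le]
      constructor <;> linarith [j1.1, j1.2, j2.1, j2.2, j3.1, j3.2]
  · refine forall_isHermitian_of_unit (f := fun Δ => |F Δ - Δ.trace.re|)
      (fun Δ hΔ c hc => ?_) (fun Δ hΔ hs => ?_) hΔ
    · rw [hFc, Matrix.trace_smul, Complex.smul_re, smul_eq_mul, ← mul_sub, abs_mul,
        abs_of_nonneg hc]
    · obtain ⟨Δ', hΔ', hlt⟩ := hnet Δ hΔ hs.le
      have hh := hΔ.sub (hN Δ' hΔ').1
      have j1 := abs_le.1 (h2 Δ' hΔ')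
      have j2 := abs_le.1 ((hEF (Δ - Δ')).trans (hE2 _ hh))
      have j3 := abs_le.1 (abs_re_trace_le (Δ - Δ'))
      rw [← hFs] at j2
      rw [Matrix.trace_sub, Complex.sub_re] at j3
      rw [abs_le]
      constructor <;> linarith [j1.1, j1.2, j2.1, j2.2, j3.1, j3.2]

end NetArgument

end RandomPOVM
end

noncomputable section

namespace RandomPOVM

open MeasureTheory ProbabilityTheory Real
open scoped MatrixOrder ComplexOrder

/-! ### Union bound over the net -/

section UnionBound

variable {d n : ℕ} [NeZero d] {Ω : Type*} [MeasurableSpace Ω] {P : Measure Ω}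
  [IsProbabilityMeasure P] {ψ : Fin n → Ω → UnitSphere d}

theorem measureReal_quadForm_deviation_le (hind : iIndepFun ψ P)
    (hlaw : ∀ i, HasLaw (ψ i) (uniformSphere d) P) {Δ : Matrix (Fin d) (Fin d) ℂ}
    (hΔ : Δ.IsHermitian) (hs : traceNorm₂ Δ ≤ 1) {g : UnitSphere d → ℝ} (hg : Continuous g)
    (hgΔ : ∀ x, |g x| ≤ |d * quadForm Δ x|) {t : ℝ} (ht0 : 0 ≤ t) (ht1 : t ≤ 1) :
    P.real {ω | n * t ≤ |∑ i, g (ψ i ω) - n * ∫ y, g y ∂(uniformSphere d)|} ≤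
      2 * exp (-(n * t ^ 2 / 4096)) := by
  have hc : Continuous fun ψ : UnitSphere d => d * quadForm Δ ψ :=
    continuous_const.mul (continuous_quadForm_sphere Δ)
  obtain ⟨B, hB⟩ := (isCompact_range hc.abs).bddAbove
  exact measureReal_abs_sum_ge_le hind hlaw hc.measurable hg.measurable (B := B)
    (fun x => hB ⟨x, rfl⟩) hgΔ ((sphere_moments hΔ).2.2 hs) (integral_abs_le_one hΔ hs) ht0 ht1

/-- The random family satisfies the conclusion of the theorem outside of an event whose
probability is controlled by the cardinality of a net. -/
theorem measureReal_not_close_le (hn : 0 < n) (hind : iIndepFun ψ P)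
    (hlaw : ∀ i, HasLaw (ψ i) (uniformSphere d) P) {δ : ℝ} (hδ : 0 < δ) (hδ16 : δ ≤ 1 / 16) :
    P.real {ω | ¬ (IsDiscretePOVM (randomPOVM fun i => ψ i ω) ∧
      ∀ Δ : Matrix (Fin d) (Fin d) ℂ, Δ.IsHermitian →
        |povmNorm (randomPOVM fun i => ψ i ω) Δ - uniformNorm d Δ|
          ≤ 18000 * δ * uniformNorm d Δ)} ≤
      (1 + 2 / δ) ^ (4 * d ^ 2) * (4 * exp (-(n * δ ^ 2 / 4096))) := by
  have hn' : (0 : ℝ) < n := by exact_mod_cast hn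
  obtain ⟨N, hN, hcard, hnet⟩ := exists_hermitian_net (d := d) hδ
  set B₁ : Matrix (Fin d) (Fin d) ℂ → Set Ω := fun Δ =>
    {ω | n * δ ≤ |∑ i, |d * quadForm Δ (ψ i ω)| -
      n * ∫ y : UnitSphere d, |d * quadForm Δ y| ∂(uniformSphere d)|} with hB₁
  set B₂ : Matrix (Fin d) (Fin d) ℂ → Set Ω := fun Δ =>
    {ω | n * δ ≤ |∑ i, d * quadForm Δ (ψ i ω) -
      n * ∫ y : UnitSphere d, d * quadForm Δ y ∂(uniformSphere d)|} with hB₂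
  have hsub : {ω | ¬ (IsDiscretePOVM (randomPOVM fun i => ψ i ω) ∧
      ∀ Δ : Matrix (Fin d) (Fin d) ℂ, Δ.IsHermitian →
        |povmNorm (randomPOVM fun i => ψ i ω) Δ - uniformNorm d Δ|
          ≤ 18000 * δ * uniformNorm d Δ)} ⊆ ⋃ Δ ∈ N, (B₁ Δ ∪ B₂ Δ) := by
    intro ω hω
    by_contra hcon
    refine hω ?_
    simp only [Set.mem_iUnion, Set.mem_union, not_exists, not_or] at hcon
    have scale : ∀ a b : ℝ, ¬ n * δ ≤ |d * a - n * b| → |(d / n : ℝ) * a - b| ≤ δ := by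
      intro a b h
      have e : (d / n : ℝ) * a - b = (d * a - n * b) / n := by field_simp
      rw [e, abs_div, abs_of_pos hn', div_le_iff₀ hn', mul_comm δ]
      exact (not_le.1 h).le
    have h1 : ∀ Δ ∈ N, |(d / n : ℝ) * ∑ i, |quadForm Δ (ψ i ω)| - uniformNorm d Δ| ≤ δ := by
      intro Δ hΔ
      refine scale _ _ ?_
      have := (hcon Δ hΔ).1
      simpa only [hB₁, Set.mem_ofPred_eq, abs_mul, Nat.abs_cast, ← Finset.mul_sum,
        integral_const_mul, ← uniformNorm_eq (hN Δ hΔ).1] using this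
    have h2 : ∀ Δ ∈ N, |(d / n : ℝ) * ∑ i, quadForm Δ (ψ i ω) - Δ.trace.re| ≤ δ := by
      intro Δ hΔ
      refine scale _ _ ?_
      have := (hcon Δ hΔ).2
      simpa only [hB₂, Set.mem_ofPred_eq, ← Finset.mul_sum, integral_const_mul,
        (sphere_moments (hN Δ hΔ).1).1] using this
    have hclose := fun (Δ : Matrix (Fin d) (Fin d) ℂ) (hΔ : Δ.IsHermitian) =>
      close_of_close_on_net hδ (by linarith) hN hnet (fun i => ψ i ω) h1 h2 hΔ
    obtain ⟨hP, hb⟩ := randomPOVM_of_close hn (fun i => ψ i ω) (by positivity : 0 ≤ 4 * δ)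
      (by linarith) (fun Δ hΔ => uniformNorm_le_traceNorm₂ hΔ) (fun Δ hΔ => (hclose Δ hΔ).1)
      (fun Δ hΔ => (hclose Δ hΔ).2)
    refine ⟨hP, fun Δ hΔ => (hb Δ hΔ).trans ?_⟩
    -- The equivalence of norms turns the additive error into a relative one, with `18000 = 15 · 4 ·
    -- 300`.
    calc 15 * (4 * δ) * traceNorm₂ Δ ≤ 15 * (4 * δ) * (300 * uniformNorm d Δ) := by
          gcongr
          exact traceNorm₂_le_uniformNorm hΔ
      _ = 18000 * δ * uniformNorm d Δ := by ring
  have hbound : ∀ Δ ∈ N, P.real (B₁ Δ ∪ B₂ Δ) ≤ 4 * exp (-(n * δ ^ 2 / 4096)) := by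
    intro Δ hΔ
    obtain ⟨hh, hs⟩ := hN Δ hΔ
    have hc : Continuous fun ψ : UnitSphere d => d * quadForm Δ ψ :=
      continuous_const.mul (continuous_quadForm_sphere Δ)
    have b1 := measureReal_quadForm_deviation_le hind hlaw hh hs hc.abs
      (fun x => (abs_abs _).le) hδ.le (by linarith)
    have b2 := measureReal_quadForm_deviation_le hind hlaw hh hs hc (fun x => le_rfl) hδ.le
      (by linarith)
    refine (measureReal_union_le _ _).trans ?_
    linarith
  calc _ ≤ P.real (⋃ Δ ∈ N, (B₁ Δ ∪ B₂ Δ)) := measureReal_mono hsub (measure_ne_top _ _)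
    _ ≤ ∑ Δ ∈ N, P.real (B₁ Δ ∪ B₂ Δ) := measureReal_biUnion_finset_le _ _
    _ ≤ ∑ _Δ ∈ N, 4 * exp (-(n * δ ^ 2 / 4096)) := Finset.sum_le_sum hbound
    _ = N.card * (4 * exp (-(n * δ ^ 2 / 4096))) := by rw [Finset.sum_const, nsmul_eq_mul]
    _ ≤ _ := by gcongr

end UnionBound

/-- The net cardinality is beaten by the deviation probability. -/
theorem net_card_mul_exp_lt {κ ε x y : ℝ} (hκ : 0 ≤ κ) (hε : 0 < ε) (hε1 : ε < 1) {d : ℕ}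
    (hd : 1 ≤ d) (hx : 0 < x) (hxκ : x ≤ exp κ / ε)
    (hy : (4 * κ + 8) * max 1 |log ε| * (d : ℝ) ^ 2 ≤ y) :
    x ^ (4 * d ^ 2) * (4 * exp (-y)) < exp (-(1 * d)) := by
  set L := max 1 |log ε| with hL
  have hL1 : 1 ≤ L := le_max_left _ _
  have hd1 : (1 : ℝ) ≤ d := by exact_mod_cast hd
  have hlog : -log ε ≤ L := (neg_le_abs _).trans (le_max_right _ _)
  have hxe : x ≤ exp ((κ + 1) * L) := by
    calc x ≤ exp κ / ε := hxκ
      _ = exp (κ + -log ε) := by rw [exp_add, exp_neg, exp_log hε, div_eq_mul_inv]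
      _ ≤ exp ((κ + 1) * L) := by
        rw [exp_le_exp]
        nlinarith
  have h4 : (4 : ℝ) ≤ exp 2 := by
    have h := exp_one_gt_d9
    have e : exp 2 = exp 1 * exp 1 := by rw [← exp_add]; norm_num
    rw [e]
    nlinarith
  have hLd : 1 ≤ L * (d : ℝ) ^ 2 := one_le_mul_of_one_le_of_one_le hL1 (one_le_pow₀ hd1)
  have hdd : (d : ℝ) ≤ L * (d : ℝ) ^ 2 := by nlinarith
  calc x ^ (4 * d ^ 2) * (4 * exp (-y))
      ≤ exp ((κ + 1) * L) ^ (4 * d ^ 2) * (exp 2 * exp (-y)) := by gcongr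
    _ = exp (4 * ((κ + 1) * (L * (d : ℝ) ^ 2)) + (2 + -y)) := by
        rw [← exp_nat_mul, ← exp_add, ← exp_add]
        push_cast
        ring_nf
    _ < exp (-(1 * d)) := by
        -- With `X = L d²`, the exponent is at most `4 (κ + 1) X + 2 - (4κ + 8) X = 2 - 4X`, which
        -- is below `-d` because `X ≥ 1` and `X ≥ d`.
        rw [exp_lt_exp]
        nlinarith

end RandomPOVM

end

/-! ### Choice of constants and conclusion -/

theorem theorem4p2 :
    ∃ C : ℝ, 0 < C ∧ ∀ ε : ℝ, 0 < ε → ε < 1 →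
      ∃ c : ℝ, 0 < c ∧ ∀ d n : ℕ, 1 ≤ d →
        C * (ε ^ 2)⁻¹ * max 1 |Real.log ε| * (d : ℝ) ^ 2 ≤ (n : ℝ) →
        ∀ (Ω : Type*) [MeasurableSpace Ω] (P : MeasureTheory.Measure Ω)
          [MeasureTheory.IsProbabilityMeasure P]
          (ψ : Fin n → Ω → RandomPOVM.UnitSphere d),
          ProbabilityTheory.iIndepFun ψ P →
          (∀ i, ProbabilityTheory.HasLaw (ψ i) (RandomPOVM.uniformSphere d) P) →
          P.real {ω | ¬ (RandomPOVM.IsDiscretePOVM (RandomPOVM.randomPOVM fun i => ψ i ω) ∧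
              ∀ Δ : Matrix (Fin d) (Fin d) ℂ, Δ.IsHermitian →
                (1 - ε) * RandomPOVM.uniformNorm d Δ
                    ≤ RandomPOVM.povmNorm (RandomPOVM.randomPOVM fun i => ψ i ω) Δ ∧
                RandomPOVM.povmNorm (RandomPOVM.randomPOVM fun i => ψ i ω) Δ
                    ≤ (1 + ε) * RandomPOVM.uniformNorm d Δ)}
            < Real.exp (-(c * d)) := by
  -- For `δ = ε / 20000` the base of the net bound is `1 + 2/δ = (ε + 40000) / ε ≤ exp κ / ε`.
  set κ : ℝ := Real.log 40001 with hκ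
  have hκ0 : 0 ≤ κ := Real.log_nonneg (by norm_num)
  -- The factor `4096 · 20000²` cancels `δ² / 4096` up to `ε²`, leaving the exponent required by
  -- `net_card_mul_exp_lt`. The rate is `c = 1` for every `ε`.
  refine ⟨4096 * 20000 ^ 2 * (4 * κ + 8), by positivity, fun ε hε hε1 => ⟨1, one_pos, ?_⟩⟩
  intro d n hd hn Ω _ P _ ψ hind hlaw
  have : NeZero d := ⟨by omega⟩
  have hd0 : (0 : ℝ) < d := by exact_mod_cast hd
  have hn0 : 0 < n := by
    have : (0 : ℝ) < n := lt_of_lt_of_le (by positivity) hn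
    exact_mod_cast this
  set δ := ε / 20000 with hδ
  have hδ0 : 0 < δ := by positivity
  have hmain := RandomPOVM.measureReal_not_close_le hn0 hind hlaw hδ0 (by linarith)
  refine lt_of_le_of_lt (MeasureTheory.measureReal_mono fun ω hω => ?_)
    (hmain.trans_lt (RandomPOVM.net_card_mul_exp_lt hκ0 hε hε1 hd (by positivity) ?_ ?_))
  · refine fun hgood => hω ⟨hgood.1, fun Δ hΔ => ?_⟩
    have h := hgood.2 Δ hΔ
    have hU : 0 ≤ RandomPOVM.uniformNorm d Δ := by
      have h1 := RandomPOVM.traceNorm₂_le_uniformNorm hΔ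
      have h2 := RandomPOVM.traceNorm₂_nonneg Δ
      linarith
    have h' : 18000 * δ * RandomPOVM.uniformNorm d Δ ≤ ε * RandomPOVM.uniformNorm d Δ := by
      gcongr
      linarith
    have h3 := abs_le.1 (h.trans h')
    constructor <;> linarith [h3.1, h3.2]
  · rw [hκ, Real.exp_log (by norm_num), hδ, le_div_iff₀ hε]
    have : (1 + 2 / (ε / 20000)) * ε = ε + 40000 := by field_simp; ring
    rw [this]
    linarith
  · have hn2 := mul_le_mul_of_nonneg_right hn (by positivity : 0 ≤ δ ^ 2 / 4096)
    refine le_trans (le_of_eq ?_) (hn2.trans (le_of_eq (by ring)))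
    rw [hδ]
    field_simp
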